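/- Let $V$ be a complex vector space of dimension $n$ with a Hermitian inner product, and let $\omega$ be the associated positive $(1,1)$-form. Let $L u=\omega\wedge u$ be the Lefschetz operator on the exterior algebra $\bigwedge^* V^*$ of complex-valued forms on $V$, let $\Lambda$ be its adjoint for the induced Hermitian inner product on forms, with norm $|\cdot|$, and let $\mathbf I=\sum_{p,q} i^{p-q}\pi_{p,q}$, where $\pi_{p,q}$ is the orthogonal projection onto the space $\bigwedge^{p,q}V^*$ of $(p,q)$-forms. For an element $A$ of an algebra write $A^{[k]}=A^k/k!$ for $k\ge 0$, and $A^{[k]}=0$ for $k<0$; a form $v$ is primitive if $\Lambda v=0$. Let $p\le q$, let $u$ be a $(p,q)$-form, and let $u=\sum_{j=0}^p u_j\wedge\omega^{[p-j]}=\sum_{j=0}^p L^{[p-j]}u_j$ be its primitive decomposition, where each $u_j$ is a primitive $(j,j+q-p)$-form. Then for every integer $l\ge 0$ $$ \Lambda^{[l]}u\wedge\Lambda^{[l]}\overline{\mathbf I u}\wedge\omega^{[n-p-q+2l]} =\sum_{j=0}^{p-l}(-1)^j(-1)^{(q-p)(q-p+1)/2}\binom{p-j}{l}\binom{n-j-q+l}{p-l-j}\binom{n-j-q+l}{l}\,\bigl|L^{[p-j]}u_j\bigr|^2\,\omega^{[n]},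 $$ where the sum is empty if $l>p$. (If $n-j-q+l<0$, then $L^{[p-j]}u_j=0$, and the $j$-th term is $0$.) -/

import Mathlib

open scoped ComplexConjugate Nat

noncomputable section

/-- Complex-valued exterior forms on a complex vector space `V`: the exterior algebra over `ℂ` of
the space `V →ₗ[ℝ] ℂ` of complex-valued real-linear forms, i.e. of the complexification of the real
dual of `V`.  The product of this algebra is the wedge product. -/
abbrev Forms (V : Type*) [NormedAddCommGroup V] [InnerProductSpace ℂ V] : Type _ :=
  ExteriorAlgebra ℂ (V →ₗ[ℝ] ℂ)

namespace Forms

variable {V : Type*} [NormedAddCommGroup V] [InnerProductSpace ℂ V] {n : ℕ}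

/-! ### Complex conjugation -/

/-- The complex conjugate `v ↦ conj (α v)` of a covector. -/
def conjCovector (α : V →ₗ[ℝ] ℂ) : V →ₗ[ℝ] ℂ := Complex.conjAe.toLinearMap ∘ₗ α

@[simp] theorem conjCovector_apply (α : V →ₗ[ℝ] ℂ) (v : V) : conjCovector α v = conj (α v) := rfl

/-- The ring of forms with the conjugate complex structure, in which `c` acts as `conj c`. It is
used only to construct the conjugation of forms from the universal property. -/
def ConjForms (V : Type*) [NormedAddCommGroup V] [InnerProductSpace ℂ V] : Type _ := Forms V

instance : Ring (ConjForms V) := inferInstanceAs (Ring (Forms V))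

instance : Algebra ℂ (ConjForms V) :=
  RingHom.toAlgebra' ((algebraMap ℂ (Forms V)).comp (starRingEnd ℂ))
    (fun c x => Algebra.commutes (A := Forms V) (conj c) x)

theorem conjForms_smul (c : ℂ) (x : ConjForms V) :
    c • x = (show ConjForms V from (conj c • (show Forms V from x) : Forms V)) :=
  (Algebra.smul_def (A := Forms V) (conj c) x).symm

/-- A covector maps to its conjugate, complex linearly for the conjugate complex structure. -/
def conjι : (V →ₗ[ℝ] ℂ) →ₗ[ℂ] ConjForms V where
  toFun α := (ExteriorAlgebra.ι ℂ (conjCovector α) : Forms V)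
  map_add' α β := by
    have h : conjCovector (α + β) = conjCovector α + conjCovector β := by ext v; simp
    exact (congrArg (ExteriorAlgebra.ι ℂ) h).trans (map_add _ _ _)
  map_smul' c α := by
    have h : conjCovector (c • α) = conj c • conjCovector α := by ext v; simp
    exact ((congrArg (ExteriorAlgebra.ι ℂ) h).trans (map_smul _ _ _)).trans
      (conjForms_smul c (ExteriorAlgebra.ι ℂ (conjCovector α) : Forms V)).symm

/-- Complex conjugation `u ↦ ū` of forms: the conjugate-linear ring homomorphism that sends every
covector to its complex conjugate. -/
def conjForm : Forms V →+* Forms V :=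
  (ExteriorAlgebra.lift ℂ (A := ConjForms V)
    ⟨conjι, fun α => ExteriorAlgebra.ι_sq_zero (R := ℂ) (conjCovector α)⟩).toRingHom

theorem conjForm_ι (α : V →ₗ[ℝ] ℂ) :
    conjForm (ExteriorAlgebra.ι ℂ α) = ExteriorAlgebra.ι ℂ (conjCovector α) :=
  ExteriorAlgebra.lift_ι_apply ℂ (A := ConjForms V) conjι _ α

theorem conjForm_smul (c : ℂ) (u : Forms V) : conjForm (c • u) = conj c • conjForm u :=
  (map_smul (ExteriorAlgebra.lift ℂ (A := ConjForms V)
    ⟨conjι, fun α => ExteriorAlgebra.ι_sq_zero (R := ℂ) (conjCovector α)⟩) c u).trans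
    (conjForms_smul c _)

/-! ### Forms of type `(p,q)` -/

/-- The space of `(1,0)`-forms: the complex-linear covectors. -/
def holForms (V : Type*) [NormedAddCommGroup V] [InnerProductSpace ℂ V] :
    Submodule ℂ (Forms V) :=
  Submodule.span ℂ {x | ∃ α : V →ₗ[ℂ] ℂ, x = ExteriorAlgebra.ι ℂ (α.restrictScalars ℝ)}

/-- The space of `(0,1)`-forms: the conjugates of the complex-linear covectors. -/
def antiholForms (V : Type*) [NormedAddCommGroup V] [InnerProductSpace ℂ V] :
    Submodule ℂ (Forms V) :=
  Submodule.span ℂ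
    {x | ∃ α : V →ₗ[ℂ] ℂ, x = ExteriorAlgebra.ι ℂ (conjCovector (α.restrictScalars ℝ))}

/-- The space `⋀^{p,q} V^*` of `(p,q)`-forms, spanned by the wedge products of `p` forms of type
`(1,0)` and `q` forms of type `(0,1)` (products and powers are those of subspaces of an algebra). -/
def typeForms (V : Type*) [NormedAddCommGroup V] [InnerProductSpace ℂ V] (p q : ℕ) :
    Submodule ℂ (Forms V) :=
  holForms V ^ p * antiholForms V ^ q

/-! ### The Hermitian inner product on forms -/

/-- The complex coordinate `z_j` of an orthonormal basis of `V`, as a covector. -/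
def dz (b : OrthonormalBasis (Fin n) ℂ V) (j : Fin n) : V →ₗ[ℝ] ℂ :=
  (b.toBasis.coord j).restrictScalars ℝ

/-- The unitary coframe `θ_1, …, θ_n, θ̄_1, …, θ̄_n` of an orthonormal basis of `V`, where
`θ_j = dz_j / √2`.  With `z_j = x_j + i y_j`, the real covectors `dx_j`, `dy_j` are orthonormal for
the real inner product on the dual of `V` induced by `Re ⟪·,·⟫`, and so `θ_j`, `θ̄_j` are orthonormal
for its Hermitian extension. -/
def coframeVec (b : OrthonormalBasis (Fin n) ℂ V) (i : Fin n ⊕ₗ Fin n) : V →ₗ[ℝ] ℂ :=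
  Sum.elim (fun j => ((√2 : ℝ) : ℂ)⁻¹ • dz b j) (fun j => ((√2 : ℝ) : ℂ)⁻¹ • conjCovector (dz b j))
    (ofLex i)

theorem coframe_linearIndependent (b : OrthonormalBasis (Fin n) ℂ V) :
    LinearIndependent ℂ (coframeVec b) := by
  classical
  rw [Fintype.linearIndependent_iff]
  intro g hg
  have hs : ((√2 : ℝ) : ℂ)⁻¹ ≠ 0 := by simp
  have key : ∀ v : V, (∑ j, g (toLex (Sum.inl j)) * b.toBasis.coord j v) +
      ∑ j, g (toLex (Sum.inr j)) * conj (b.toBasis.coord j v) = 0 := by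
    intro v
    have h := congrArg (fun f : V →ₗ[ℝ] ℂ => f v) hg
    simp only [LinearMap.sum_apply, LinearMap.smul_apply, LinearMap.zero_apply] at h
    rw [← (toLex : Fin n ⊕ Fin n ≃ _).sum_comp, Fintype.sum_sum_type] at h
    simp only [coframeVec, ofLex_toLex, Sum.elim_inl, Sum.elim_inr, LinearMap.smul_apply, dz,
      conjCovector_apply, LinearMap.coe_restrictScalars, smul_eq_mul] at h
    have h2 : ((√2 : ℝ) : ℂ)⁻¹ * ((∑ j, g (toLex (Sum.inl j)) * b.toBasis.coord j v) +
      ∑ j, g (toLex (Sum.inr j)) * conj (b.toBasis.coord j v)) = 0 := by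
      rw [← h, mul_add, Finset.mul_sum, Finset.mul_sum]
      congr 1 <;> exact Finset.sum_congr rfl fun j _ => by ring
    exact (mul_eq_zero.mp h2).resolve_left hs
  have e1 : ∀ j, g (toLex (Sum.inl j)) + g (toLex (Sum.inr j)) = 0 := fun j => by
    have h := key (b.toBasis j)
    simpa [Module.Basis.coord_apply, Finsupp.single_apply, apply_ite] using h
  have e2 : ∀ j, g (toLex (Sum.inl j)) - g (toLex (Sum.inr j)) = 0 := fun j => by
    have h := key (Complex.I • b.toBasis j)
    simp only [map_smul, Module.Basis.coord_apply, Module.Basis.repr_self, Finsupp.single_apply,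
      smul_eq_mul, mul_ite, mul_one, mul_zero, apply_ite (starRingEnd ℂ), Complex.conj_I, map_zero,
      Finset.sum_ite_eq, Finset.mem_univ, if_true] at h
    have h3 : Complex.I * (g (toLex (Sum.inl j)) - g (toLex (Sum.inr j))) = 0 := by
      rw [← h]; ring
    exact (mul_eq_zero.mp h3).resolve_left Complex.I_ne_zero
  intro i
  rcases h : ofLex i with j | j
  · have : i = toLex (Sum.inl j) := by rw [← h]; rfl
    rw [this]; linear_combination (e1 j + e2 j) / 2
  · have : i = toLex (Sum.inr j) := by rw [← h]; rfl
    rw [this]; linear_combination (e1 j - e2 j) / 2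

theorem coframe_span (b : OrthonormalBasis (Fin n) ℂ V) :
    ⊤ ≤ Submodule.span ℂ (Set.range (coframeVec b)) := by
  intro α _
  have hs : ((√2 : ℝ) : ℂ) * ((√2 : ℝ) : ℂ)⁻¹ = 1 := mul_inv_cancel₀ (by simp)
  have hα : α = ∑ j : Fin n,
      ((((√2 : ℝ) : ℂ) * (α (b j) - Complex.I * α (Complex.I • b j)) / 2) •
          coframeVec b (toLex (Sum.inl j)) +
        (((√2 : ℝ) : ℂ) * (α (b j) + Complex.I * α (Complex.I • b j)) / 2) •
          coframeVec b (toLex (Sum.inr j))) := by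
    ext v
    conv_lhs => rw [← b.toBasis.sum_repr v]
    rw [map_sum, LinearMap.sum_apply]
    refine Finset.sum_congr rfl fun j _ => ?_
    have hc : b.toBasis.repr v j • b.toBasis j =
        (b.toBasis.repr v j).re • b j + (b.toBasis.repr v j).im • (Complex.I • b j) := by
      rw [OrthonormalBasis.coe_toBasis, ← Complex.coe_smul, ← Complex.coe_smul, smul_smul,
        ← add_smul, Complex.re_add_im]
    have hz : (b.toBasis.repr v j) = (b.toBasis.repr v j).re + (b.toBasis.repr v j).im * Complex.I :=
      (Complex.re_add_im _).symm
    rw [hc, map_add, map_smul, map_smul]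
    simp only [coframeVec, ofLex_toLex, Sum.elim_inl, Sum.elim_inr, LinearMap.add_apply,
      LinearMap.smul_apply, dz, conjCovector_apply, LinearMap.coe_restrictScalars, smul_eq_mul,
      Module.Basis.coord_apply, Complex.real_smul]
    generalize b.toBasis.repr v j = z at *
    have hz' : conj z = z.re - z.im * Complex.I := by
      apply Complex.ext <;> simp
    generalize z.re = x at *
    generalize z.im = y at *
    rw [hz', hz]
    linear_combination (-(x * α (b j)) - y * α (Complex.I • b j)) * hs +
      (y * α (Complex.I • b j)) * ((√2 : ℝ) : ℂ) * ((√2 : ℝ) : ℂ)⁻¹ * Complex.I_mul_I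
  rw [hα]
  exact Submodule.sum_mem _ fun j _ => Submodule.add_mem _
    (Submodule.smul_mem _ _ (Submodule.subset_span ⟨_, rfl⟩))
    (Submodule.smul_mem _ _ (Submodule.subset_span ⟨_, rfl⟩))

/-- The unitary coframe as a complex basis of the complex-valued covectors, ordered as
`θ_1, …, θ_n, θ̄_1, …, θ̄_n`. -/
def coframe (b : OrthonormalBasis (Fin n) ℂ V) :
    Module.Basis (Fin n ⊕ₗ Fin n) ℂ (V →ₗ[ℝ] ℂ) :=
  Module.Basis.mk (coframe_linearIndependent b) (coframe_span b)

/-- Coordinates of a form in the basis of all ordered wedge products of distinct elements of the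
unitary coframe.  The Hermitian inner product on forms is the one for which this basis is
orthonormal, i.e. the pullback of the standard inner product under this map. -/
def orthoCoord (b : OrthonormalBasis (Fin n) ℂ V) :
    Forms V ≃ₗ[ℂ] EuclideanSpace ℂ (Finset (Fin n ⊕ₗ Fin n)) :=
  (coframe b).ExteriorAlgebra.equivFun ≪≫ₗ (WithLp.linearEquiv 2 ℂ _).symm

/-- The square norm `|u|²` of a form. -/
def normSq (b : OrthonormalBasis (Fin n) ℂ V) (u : Forms V) : ℝ := ‖orthoCoord b u‖ ^ 2

/-- The adjoint of an endomorphism for the Hermitian inner product on forms. -/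
def adjointOp (b : OrthonormalBasis (Fin n) ℂ V) (T : Module.End ℂ (Forms V)) :
    Module.End ℂ (Forms V) :=
  (orthoCoord b).symm.toLinearMap ∘ₗ
    LinearMap.adjoint ((orthoCoord b).toLinearMap ∘ₗ T ∘ₗ (orthoCoord b).symm.toLinearMap) ∘ₗ
      (orthoCoord b).toLinearMap

/-- The orthogonal projection of forms onto a subspace. -/
def orthProj (b : OrthonormalBasis (Fin n) ℂ V) (W : Submodule ℂ (Forms V)) :
    Module.End ℂ (Forms V) :=
  (orthoCoord b).symm.toLinearMap ∘ₗ
    (W.map (orthoCoord b).toLinearMap).starProjection.toLinearMap ∘ₗ (orthoCoord b).toLinearMap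

/-! ### The Lefschetz operators and the operator `𝐈` -/

/-- The positive `(1,1)`-form `ω = (i/2) ∑ dz_j ∧ dz̄_j = ∑ dx_j ∧ dy_j` of the Hermitian inner
product of `V`. -/
def omega (b : OrthonormalBasis (Fin n) ℂ V) : Forms V :=
  (Complex.I / 2) • ∑ j, ExteriorAlgebra.ι ℂ (dz b j) * ExteriorAlgebra.ι ℂ (conjCovector (dz b j))

/-- The Lefschetz operator `L u = ω ∧ u`. -/
def lefschetz (b : OrthonormalBasis (Fin n) ℂ V) : Module.End ℂ (Forms V) :=
  LinearMap.mulLeft ℂ (omega b)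

/-- The adjoint `Λ` of the Lefschetz operator. -/
def dualLefschetz (b : OrthonormalBasis (Fin n) ℂ V) : Module.End ℂ (Forms V) :=
  adjointOp b (lefschetz b)

/-- The operator `𝐈 = ∑_{p,q} i^{p-q} π_{p,q}`, where `π_{p,q}` is the orthogonal projection onto
the `(p,q)`-forms. -/
def opI (b : OrthonormalBasis (Fin n) ℂ V) : Module.End ℂ (Forms V) :=
  ∑ p ∈ Finset.range (n + 1), ∑ q ∈ Finset.range (n + 1),
    (Complex.I ^ ((p : ℤ) - (q : ℤ))) • orthProj b (typeForms V p q)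

/-- The divided power `A^{[k]} = A^k / k!` in a complex algebra, which is `0` for `k < 0`. -/
def divPow {R : Type*} [Ring R] [Algebra ℂ R] (a : R) (k : ℤ) : R :=
  if 0 ≤ k then ((k.toNat ! : ℂ))⁻¹ • a ^ k.toNat else 0

/-- `u = ∑_{j=0}^p u_j ∧ ω^{[p-j]}` is a primitive decomposition of a `(p,q)`-form `u`, where
`p ≤ q`: each `u_j` is a `(j,j+q-p)`-form and primitive, i.e. `Λ u_j = 0`. -/
structure IsPrimitiveDecomposition (b : OrthonormalBasis (Fin n) ℂ V) (p q : ℕ) (u : Forms V)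
    (c : ℕ → Forms V) : Prop where
  mem_type : ∀ j ≤ p, c j ∈ typeForms V j (j + (q - p))
  primitive : ∀ j ≤ p, dualLefschetz b (c j) = 0
  eq_sum : u = ∑ j ∈ Finset.range (p + 1), c j * divPow (omega b) ((p : ℤ) - j)

end Forms

end

/-! The operators `L`, `Λ` and `n - deg` form an `𝔰𝔩₂`-triple on forms. For a primitive `x` of
degree `k` the string `x, Lx, L²x, …` therefore vanishes beyond `L^{n-k} x`, and `Λ^{[l]} L^{[l+t]}
x` is `L^{[t]} x` times the binomial coefficient of `n-k-t` over `l`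
(`divPow_divPow_apply_of_primitive`). This expands `Λ^{[l]} u` in the forms `u_j ∧ ω^{[p-l-j]}` and
gives `|L^{[r]} x|²` as a binomial multiple of `|x|²`.

In the resulting double sum, the `(i,j)` term carries `ω` to the power `n-(q-p)-i-j`. For `i ≠ j`
this exceeds the length `n-(q-p)-2 max(i,j)` of the shorter string, so the term is zero
(`mul_conjForm_eq_zero`). For `i = j` the power is exactly `n-k`. The Hodge–Riemann relation
evaluates `x ∧ x̄ ∧ ω^{[n-k]}` (`mul_conjForm_mul_divPow_omega`), and a binomial identity remains
(`choose_mul_choose_mul_choose`).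

The Hodge–Riemann relation is obtained without a Hodge star, from `w = exp(L) exp(-Λ) exp(L)`.
Conjugation by `w` exchanges, up to `±i`, the wedge product with `θ_j` and the contraction of `θ̄_j`
(and likewise with bars swapped), and `w 1 = ω^{[n]}`. Contractions are antiderivations, adjoint to
wedge products, with image orthogonal to `ω^{[n]}`. Building forms up from `1` one covector at a
time then gives `⟨ω^{[n]}, w x ∧ ȳ⟩ = ± i^{p-q} ⟨y, x⟩` (`hermInner_weylOp_mul_conjForm`). On a
primitive `x` of degree `k`, `w x = L^{[n-k]} x` (`exp_exp_exp_apply_of_primitive`). -/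

noncomputable section

namespace Forms

/-! ### Wedge and contraction by the coframe as adjoint operators -/

section Wedge

section Basis

open CliffordAlgebra (contractLeft)

variable {I M : Type*} [LinearOrder I] [AddCommGroup M] [Module ℂ M] (e : Module.Basis I ℂ M)

theorem exteriorBasis_empty : e.ExteriorAlgebra ∅ = 1 := by
  rw [ExteriorAlgebra.basis_apply_ofCard e (n := 0) (by simp)]
  simp [ExteriorAlgebra.ιMulti_family, ExteriorAlgebra.ιMulti_apply]

theorem exteriorBasis_singleton (i : I) :
    e.ExteriorAlgebra {i} = ExteriorAlgebra.ι ℂ (e i) := by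
  rw [ExteriorAlgebra.basis_apply_ofCard e (n := 1) (by simp)]
  simp only [ExteriorAlgebra.ιMulti_family, ExteriorAlgebra.ιMulti_apply, List.ofFn_succ,
    List.ofFn_zero, List.prod_cons, List.prod_nil, mul_one, Function.comp]
  congr 2
  have h := Finset.orderEmbOfFin_mem ({i} : Finset I) (Finset.card_singleton i) 0
  exact Finset.mem_singleton.mp h

variable [DecidableEq I]

theorem ι_mul_exteriorBasis_of_mem {i : I} {S : Finset I} (h : i ∈ S) :
    ExteriorAlgebra.ι ℂ (e i) * e.ExteriorAlgebra S = 0 := by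
  rw [← exteriorBasis_singleton]
  exact ExteriorAlgebra.basis_mul_of_not_disjoint e
    (Set.powersetCard.ofCard (Finset.card_singleton i)) (Set.powersetCard.ofCard (rfl : S.card = _))
    (by simpa using h)

theorem ι_mul_exteriorBasis_of_notMem {i : I} {S : Finset I} (h : i ∉ S) :
    ∃ ε : ℤˣ, ExteriorAlgebra.ι ℂ (e i) * e.ExteriorAlgebra S =
      ε • e.ExteriorAlgebra (insert i S) := by
  rw [← exteriorBasis_singleton]
  have hd : Disjoint (Set.powersetCard.ofCard (Finset.card_singleton i)).val
    (Set.powersetCard.ofCard (rfl : S.card = _)).val := by simpa using h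
  have hu : (Set.powersetCard.disjUnion hd).val = insert i S := by
    ext x
    simp [Set.powersetCard.coe_disjUnion]
  have h := ExteriorAlgebra.basis_mul_of_disjoint e _ _ hd
  rw [hu] at h
  exact ⟨_, h⟩

theorem contractLeft_exteriorBasis_of_notMem {i : I} {S : Finset I} (h : i ∉ S) :
    contractLeft (Q := (0 : QuadraticForm ℂ M)) (e.coord i) (e.ExteriorAlgebra S) = 0 := by
  induction S using Finset.induction_on with
  | empty =>
    rw [exteriorBasis_empty]
    exact CliffordAlgebra.contractLeft_one _ _
  | insert a S ha ih =>
    obtain ⟨hia, hiS⟩ : i ≠ a ∧ i ∉ S := by simpa using h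
    obtain ⟨ε, hε⟩ := ι_mul_exteriorBasis_of_notMem e ha
    rw [← inv_smul_eq_iff] at hε
    rw [← hε, Units.smul_def, map_zsmul]
    erw [CliffordAlgebra.contractLeft_ι_mul]
    rw [ih hiS]
    simp [hia.symm]

/-- The sign is that of the wedge product because a sign is its own inverse. Keeping the same `ε` is
what makes the two operators adjoint. -/
theorem contractLeft_exteriorBasis_insert {i : I} {S : Finset I} (h : i ∉ S) {ε : ℤˣ}
    (hε : ExteriorAlgebra.ι ℂ (e i) * e.ExteriorAlgebra S = ε • e.ExteriorAlgebra (insert i S)) :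
    contractLeft (Q := (0 : QuadraticForm ℂ M)) (e.coord i) (e.ExteriorAlgebra (insert i S)) =
      ε • e.ExteriorAlgebra S := by
  rw [← inv_smul_eq_iff] at hε
  rw [← hε, Units.smul_def, map_zsmul]
  erw [CliffordAlgebra.contractLeft_ι_mul]
  rw [contractLeft_exteriorBasis_of_notMem e h]
  simp [Units.smul_def]

end Basis

variable {V : Type*} [NormedAddCommGroup V] [InnerProductSpace ℂ V] {n : ℕ}

/-- The Hermitian inner product on forms, conjugate-linear in the first variable. -/
def hermInner (b : OrthonormalBasis (Fin n) ℂ V) (x y : Forms V) : ℂ :=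
  inner ℂ (orthoCoord b x) (orthoCoord b y)

/-- Left multiplication by an element of the unitary coframe. -/
def wedgeOp (b : OrthonormalBasis (Fin n) ℂ V) (s : Fin n ⊕ₗ Fin n) : Module.End ℂ (Forms V) :=
  LinearMap.mulLeft ℂ (ExteriorAlgebra.ι ℂ (coframe b s))

/-- Contraction with an element of the frame dual to the unitary coframe. -/
def contractOp (b : OrthonormalBasis (Fin n) ℂ V) (s : Fin n ⊕ₗ Fin n) : Module.End ℂ (Forms V) :=
  CliffordAlgebra.contractLeft (Q := (0 : QuadraticForm ℂ (V →ₗ[ℝ] ℂ))) ((coframe b).coord s)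

variable (b : OrthonormalBasis (Fin n) ℂ V)

theorem wedgeOp_apply (s : Fin n ⊕ₗ Fin n) (x : Forms V) :
    wedgeOp b s x = ExteriorAlgebra.ι ℂ (coframe b s) * x := rfl

theorem contractOp_ι_mul (s : Fin n ⊕ₗ Fin n) (α : V →ₗ[ℝ] ℂ) (x : Forms V) :
    contractOp b s (ExteriorAlgebra.ι ℂ α * x) =
      (coframe b).coord s α • x - ExteriorAlgebra.ι ℂ α * contractOp b s x :=
  CliffordAlgebra.contractLeft_ι_mul _ _ _

theorem contractOp_algebraMap (s : Fin n ⊕ₗ Fin n) (r : ℂ) :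
    contractOp b s (algebraMap ℂ (Forms V) r) = 0 :=
  CliffordAlgebra.contractLeft_algebraMap _ _ _

theorem contractOp_one (s : Fin n ⊕ₗ Fin n) : contractOp b s 1 = 0 :=
  CliffordAlgebra.contractLeft_one _ _

theorem orthoCoord_exteriorBasis (S : Finset (Fin n ⊕ₗ Fin n)) :
    orthoCoord b ((coframe b).ExteriorAlgebra S) = EuclideanSpace.single S 1 := by
  ext T
  simp [orthoCoord, EuclideanSpace.single, Finsupp.single_apply, eq_comm]

theorem hermInner_exteriorBasis (S T : Finset (Fin n ⊕ₗ Fin n)) :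
    hermInner b ((coframe b).ExteriorAlgebra S) ((coframe b).ExteriorAlgebra T) =
      if S = T then 1 else 0 := by
  rw [hermInner, orthoCoord_exteriorBasis, orthoCoord_exteriorBasis]
  simp [EuclideanSpace.inner_single_left]

theorem hermInner_add_left (x y z : Forms V) :
    hermInner b (x + y) z = hermInner b x z + hermInner b y z := by
  simp [hermInner]

theorem hermInner_add_right (x y z : Forms V) :
    hermInner b x (y + z) = hermInner b x y + hermInner b x z := by
  simp [hermInner]

theorem hermInner_smul_left (c : ℂ) (x y : Forms V) :
    hermInner b (c • x) y = conj c * hermInner b x y := by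
  simp [hermInner, mul_comm]

theorem hermInner_smul_right (c : ℂ) (x y : Forms V) :
    hermInner b x (c • y) = c * hermInner b x y := by
  simp [hermInner]

theorem hermInner_zero_left (x : Forms V) : hermInner b 0 x = 0 := by simp [hermInner]

theorem hermInner_zero_right (x : Forms V) : hermInner b x 0 = 0 := by simp [hermInner]

theorem hermInner_sum_left {ι : Type*} (s : Finset ι) (f : ι → Forms V) (y : Forms V) :
    hermInner b (∑ i ∈ s, f i) y = ∑ i ∈ s, hermInner b (f i) y := by
  simp [hermInner]

theorem hermInner_sum_right {ι : Type*} (s : Finset ι) (f : ι → Forms V) (y : Forms V) :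
    hermInner b y (∑ i ∈ s, f i) = ∑ i ∈ s, hermInner b y (f i) := by
  simp [hermInner]

theorem hermInner_self (x : Forms V) : hermInner b x x = (normSq b x : ℂ) := by
  simp [hermInner, normSq, inner_self_eq_norm_sq_to_K]

theorem eq_zero_of_hermInner_self {x : Forms V} (h : hermInner b x x = 0) : x = 0 := by
  simpa [hermInner] using h

theorem ext_hermInner {x y : Forms V} (h : ∀ z, hermInner b z x = hermInner b z y) : x = y := by
  refine (orthoCoord b).injective (ext_inner_left ℂ fun v => ?_)
  simpa [hermInner] using h ((orthoCoord b).symm v)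

/-- In the orthonormal basis of monomials the two operators have transposed matrices with real
entries `0, ±1`, so it suffices to compare them on pairs of basis elements. -/
theorem hermInner_wedgeOp_left (s : Fin n ⊕ₗ Fin n) (x y : Forms V) :
    hermInner b (wedgeOp b s x) y = hermInner b x (contractOp b s y) := by
  have hx := (coframe b).ExteriorAlgebra.mem_span x
  have hy := (coframe b).ExteriorAlgebra.mem_span y
  induction hx using Submodule.span_induction with
  | zero => simp [hermInner_zero_left]
  | add x x' _ _ h h' => simp only [map_add, hermInner_add_left, h, h']
  | smul c x _ h => simp only [map_smul, hermInner_smul_left, h]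
  | mem x hx =>
  obtain ⟨S, rfl⟩ := hx
  induction hy using Submodule.span_induction with
  | zero => simp [hermInner_zero_right]
  | add x x' _ _ h h' => simp only [map_add, hermInner_add_right, h, h']
  | smul c x _ h => simp only [map_smul, hermInner_smul_right, h]
  | mem y hy =>
  obtain ⟨T, rfl⟩ := hy
  have zsmul_left : ∀ (ε : ℤˣ) (x y : Forms V),
      hermInner b (ε • x) y = ((ε : ℤ) : ℂ) * hermInner b x y := fun ε x y => by
    rw [Units.smul_def, ← Int.cast_smul_eq_zsmul ℂ, hermInner_smul_left]; simp
  have zsmul_right : ∀ (ε : ℤˣ) (x y : Forms V),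
      hermInner b x (ε • y) = ((ε : ℤ) : ℂ) * hermInner b x y := fun ε x y => by
    rw [Units.smul_def, ← Int.cast_smul_eq_zsmul ℂ, hermInner_smul_right]
  by_cases hT : s ∈ T
  · obtain ⟨T, hsT, rfl⟩ : ∃ T', s ∉ T' ∧ insert s T' = T :=
      ⟨T.erase s, Finset.notMem_erase _ _, Finset.insert_erase hT⟩
    obtain ⟨ε, hε⟩ := ι_mul_exteriorBasis_of_notMem (coframe b) hsT
    have h2 : contractOp b s ((coframe b).ExteriorAlgebra (insert s T)) = _ :=
      contractLeft_exteriorBasis_insert (coframe b) hsT hε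
    rw [h2, zsmul_right, hermInner_exteriorBasis]
    by_cases hS : s ∈ S
    · rw [wedgeOp_apply, ι_mul_exteriorBasis_of_mem _ hS, hermInner_zero_left,
        if_neg, mul_zero]
      rintro rfl
      exact hsT hS
    · by_cases hST : S = T
      · subst hST
        rw [wedgeOp_apply, hε, zsmul_left, hermInner_exteriorBasis, if_pos rfl, if_pos rfl]
      · obtain ⟨ε', hε'⟩ := ι_mul_exteriorBasis_of_notMem (coframe b) hS
        rw [wedgeOp_apply, hε', zsmul_left, hermInner_exteriorBasis, if_neg hST, if_neg]
        · simp
        · intro h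
          apply hST
          rw [← Finset.erase_insert hS, h, Finset.erase_insert hsT]
  · have h2 : contractOp b s ((coframe b).ExteriorAlgebra T) = _ :=
      contractLeft_exteriorBasis_of_notMem (coframe b) hT
    rw [h2, hermInner_zero_right]
    by_cases hS : s ∈ S
    · rw [wedgeOp_apply, ι_mul_exteriorBasis_of_mem _ hS, hermInner_zero_left]
    · obtain ⟨ε', hε'⟩ := ι_mul_exteriorBasis_of_notMem (coframe b) hS
      rw [wedgeOp_apply, hε', zsmul_left, hermInner_exteriorBasis, if_neg, mul_zero]
      rintro rfl
      exact hT (Finset.mem_insert_self _ _)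

theorem hermInner_conj_symm (x y : Forms V) : conj (hermInner b x y) = hermInner b y x := by
  simp [hermInner]

theorem hermInner_contractOp_left (s : Fin n ⊕ₗ Fin n) (x y : Forms V) :
    hermInner b (contractOp b s x) y = hermInner b x (wedgeOp b s y) := by
  rw [← hermInner_conj_symm, ← hermInner_wedgeOp_left, hermInner_conj_symm]

theorem hermInner_adjointOp_right (T : Module.End ℂ (Forms V)) (x y : Forms V) :
    hermInner b x (adjointOp b T y) = hermInner b (T x) y := by
  simp [hermInner, adjointOp, LinearMap.adjoint_inner_right]

theorem adjointOp_eq_of {T S : Module.End ℂ (Forms V)}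
    (h : ∀ x y, hermInner b (T x) y = hermInner b x (S y)) : adjointOp b T = S := by
  refine LinearMap.ext fun y => ?_
  exact ext_hermInner b fun z => by rw [hermInner_adjointOp_right, h]

end Wedge

/-! ### Commutation relations of `L`, `Λ`, wedge products and contractions -/

section Commutators

variable {V : Type*} [NormedAddCommGroup V] [InnerProductSpace ℂ V] {n : ℕ}

/-- The index of the coframe element `θ_j`. -/
def holIdx (j : Fin n) : Fin n ⊕ₗ Fin n := toLex (Sum.inl j)

/-- The index of the coframe element `θ̄_j`. -/
def antiholIdx (j : Fin n) : Fin n ⊕ₗ Fin n := toLex (Sum.inr j)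

/-- The permutation of indices that corresponds to conjugation of the coframe. -/
def barIdx (s : Fin n ⊕ₗ Fin n) : Fin n ⊕ₗ Fin n := toLex (ofLex s).swap

theorem barIdx_holIdx (j : Fin n) : barIdx (holIdx j) = antiholIdx j := rfl

theorem barIdx_antiholIdx (j : Fin n) : barIdx (antiholIdx j) = holIdx j := rfl

theorem barIdx_barIdx (s : Fin n ⊕ₗ Fin n) : barIdx (barIdx s) = s := by simp [barIdx]

theorem holIdx_inj {j k : Fin n} : holIdx j = holIdx k ↔ j = k := by simp [holIdx]

theorem antiholIdx_inj {j k : Fin n} : antiholIdx j = antiholIdx k ↔ j = k := by simp [antiholIdx]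

theorem holIdx_ne_antiholIdx (j k : Fin n) : holIdx j ≠ antiholIdx k := by
  simp [holIdx, antiholIdx]

theorem idx_cases {C : Fin n ⊕ₗ Fin n → Prop} (h : ∀ j, C (holIdx j))
    (h' : ∀ j, C (antiholIdx j)) (s : Fin n ⊕ₗ Fin n) : C s := by
  rcases hs : ofLex s with j | j
  · have : s = holIdx j := by rw [holIdx, ← hs]; rfl
    exact this ▸ h j
  · have : s = antiholIdx j := by rw [antiholIdx, ← hs]; rfl
    exact this ▸ h' j

theorem forms_induction {C : Forms V → Prop} (h0 : ∀ r, C (algebraMap ℂ (Forms V) r))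
    (hadd : ∀ x y, C x → C y → C (x + y))
    (hι : ∀ α x, C x → C (ExteriorAlgebra.ι ℂ α * x)) (x : Forms V) : C x :=
  CliffordAlgebra.left_induction (Q := (0 : QuadraticForm ℂ (V →ₗ[ℝ] ℂ))) h0 hadd
    (fun x α hx => hι α x hx) x

/-- The grading involution of forms. -/
def signOp : Forms V →ₐ[ℂ] Forms V :=
  CliffordAlgebra.involute (Q := (0 : QuadraticForm ℂ (V →ₗ[ℝ] ℂ)))

theorem signOp_ι (α : V →ₗ[ℝ] ℂ) :
    signOp (ExteriorAlgebra.ι ℂ α) = -ExteriorAlgebra.ι ℂ α :=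
  CliffordAlgebra.involute_ι α

variable (b : OrthonormalBasis (Fin n) ℂ V)

theorem coframe_holIdx (j : Fin n) : coframe b (holIdx j) = ((√2 : ℝ) : ℂ)⁻¹ • dz b j := by
  simp [coframe, coframeVec, holIdx]

theorem coframe_antiholIdx (j : Fin n) :
    coframe b (antiholIdx j) = ((√2 : ℝ) : ℂ)⁻¹ • conjCovector (dz b j) := by
  simp [coframe, coframeVec, antiholIdx]

theorem conjCovector_add (α β : V →ₗ[ℝ] ℂ) :
    conjCovector (α + β) = conjCovector α + conjCovector β := by ext v; simp

theorem conjCovector_smul (c : ℂ) (α : V →ₗ[ℝ] ℂ) :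
    conjCovector (c • α) = conj c • conjCovector α := by ext v; simp

theorem conjCovector_conjCovector (α : V →ₗ[ℝ] ℂ) :
    conjCovector (conjCovector α) = α := by ext v; simp

theorem conjCovector_coframe (s : Fin n ⊕ₗ Fin n) :
    conjCovector (coframe b s) = coframe b (barIdx s) := by
  induction s using idx_cases with
  | h j => rw [barIdx_holIdx, coframe_holIdx, coframe_antiholIdx, conjCovector_smul]; simp
  | h' j =>
    rw [barIdx_antiholIdx, coframe_holIdx, coframe_antiholIdx, conjCovector_smul,
      conjCovector_conjCovector]
    simp

theorem coord_barIdx_conjCovector (s : Fin n ⊕ₗ Fin n) (α : V →ₗ[ℝ] ℂ) :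
    (coframe b).coord (barIdx s) (conjCovector α) = conj ((coframe b).coord s α) := by
  have hα := (coframe b).mem_span α
  induction hα using Submodule.span_induction with
  | zero =>
    have : conjCovector (0 : V →ₗ[ℝ] ℂ) = 0 := by ext v; simp
    simp [this]
  | add x y _ _ hx hy => rw [conjCovector_add, map_add, map_add, map_add, hx, hy]
  | smul c x _ hx => rw [conjCovector_smul, map_smul, map_smul, hx, smul_eq_mul, smul_eq_mul, map_mul]
  | mem x hx =>
    obtain ⟨t, rfl⟩ := hx
    rw [conjCovector_coframe]
    have : barIdx t = barIdx s ↔ t = s :=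
      ⟨fun h => by rw [← barIdx_barIdx t, h, barIdx_barIdx], fun h => h ▸ rfl⟩
    simp [Module.Basis.coord_apply, Finsupp.single_apply, this, apply_ite]

theorem conjForm_algebraMap (r : ℂ) :
    conjForm (algebraMap ℂ (Forms V) r) = algebraMap ℂ (Forms V) (conj r) := by
  rw [Algebra.algebraMap_eq_smul_one, conjForm_smul, map_one, Algebra.algebraMap_eq_smul_one]

theorem conjForm_wedgeOp (s : Fin n ⊕ₗ Fin n) (x : Forms V) :
    conjForm (wedgeOp b s x) = wedgeOp b (barIdx s) (conjForm x) := by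
  rw [wedgeOp_apply, map_mul, conjForm_ι, conjCovector_coframe, wedgeOp_apply]

theorem conjForm_contractOp (s : Fin n ⊕ₗ Fin n) (x : Forms V) :
    conjForm (contractOp b s x) = contractOp b (barIdx s) (conjForm x) := by
  induction x using forms_induction with
  | h0 r => rw [conjForm_algebraMap, contractOp_algebraMap, contractOp_algebraMap, map_zero]
  | hadd x y hx hy => simp only [map_add, hx, hy]
  | hι α x hx =>
    rw [map_mul conjForm, conjForm_ι, contractOp_ι_mul, contractOp_ι_mul, map_sub, map_mul conjForm, conjForm_smul,
      conjForm_ι, hx, coord_barIdx_conjCovector]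

theorem signOp_contractOp (s : Fin n ⊕ₗ Fin n) (x : Forms V) :
    signOp (contractOp b s x) = -contractOp b s (signOp x) := by
  induction x using forms_induction with
  | h0 r => rw [AlgHom.commutes, contractOp_algebraMap, map_zero, neg_zero]
  | hadd x y hx hy => simp only [map_add, hx, hy, neg_add]
  | hι α x hx =>
    rw [map_mul signOp, signOp_ι, contractOp_ι_mul, map_sub, map_mul signOp, map_smul, signOp_ι, hx,
      neg_mul, neg_mul, map_neg, contractOp_ι_mul]
    noncomm_ring

theorem signOp_wedgeOp (s : Fin n ⊕ₗ Fin n) (x : Forms V) :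
    signOp (wedgeOp b s x) = -wedgeOp b s (signOp x) := by
  rw [wedgeOp_apply, map_mul, signOp_ι, wedgeOp_apply, neg_mul]

theorem contractOp_mul (s : Fin n ⊕ₗ Fin n) (x y : Forms V) :
    contractOp b s (x * y) = contractOp b s x * y + signOp x * contractOp b s y := by
  induction x using forms_induction with
  | h0 r =>
    rw [contractOp_algebraMap, AlgHom.commutes, ← Algebra.smul_def, ← Algebra.smul_def, map_smul,
      zero_mul, zero_add]
  | hadd x x' hx hx' => simp only [add_mul, map_add, hx, hx']; abel
  | hι α x hx =>
    rw [mul_assoc, contractOp_ι_mul, hx, contractOp_ι_mul, map_mul, signOp_ι, sub_mul,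
      smul_mul_assoc]
    noncomm_ring

theorem omega_eq : omega b = Complex.I • ∑ j,
    ExteriorAlgebra.ι ℂ (coframe b (holIdx j)) * ExteriorAlgebra.ι ℂ (coframe b (antiholIdx j)) := by
  have h2 : ((√2 : ℝ) : ℂ)⁻¹ * ((√2 : ℝ) : ℂ)⁻¹ = 1 / 2 := by
    rw [← mul_inv, ← Complex.ofReal_mul, Real.mul_self_sqrt (by norm_num)]; norm_num
  simp only [omega, coframe_holIdx, coframe_antiholIdx, map_smul, smul_mul_smul_comm, h2,
    ← Finset.smul_sum, smul_smul]
  congr 1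
  ring

theorem lefschetz_apply (x : Forms V) : lefschetz b x = omega b * x := rfl

theorem contractOp_wedgeOp (s t : Fin n ⊕ₗ Fin n) (x : Forms V) :
    contractOp b s (wedgeOp b t x) = (if s = t then x else 0) - wedgeOp b t (contractOp b s x) := by
  rw [wedgeOp_apply, contractOp_ι_mul, wedgeOp_apply]
  congr 1
  split_ifs with h
  · subst h; simp
  · simp [Ne.symm h]

theorem wedgeOp_contractOp (s t : Fin n ⊕ₗ Fin n) (x : Forms V) :
    wedgeOp b s (contractOp b t x) = (if t = s then x else 0) - contractOp b t (wedgeOp b s x) := by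
  rw [contractOp_wedgeOp]; abel

theorem wedgeOp_wedgeOp (s t : Fin n ⊕ₗ Fin n) (x : Forms V) :
    wedgeOp b s (wedgeOp b t x) = -wedgeOp b t (wedgeOp b s x) := by
  have h := ExteriorAlgebra.ι_add_mul_swap (R := ℂ) (coframe b s) (coframe b t)
  simp only [wedgeOp_apply, ← mul_assoc]
  rw [eq_neg_of_add_eq_zero_left h, neg_mul]

theorem contractOp_contractOp (s t : Fin n ⊕ₗ Fin n) (x : Forms V) :
    contractOp b s (contractOp b t x) = -contractOp b t (contractOp b s x) :=
  CliffordAlgebra.contractLeft_comm (Q := 0) _ _ x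

theorem lefschetz_eq_sum (x : Forms V) : lefschetz b x =
    Complex.I • ∑ j, wedgeOp b (holIdx j) (wedgeOp b (antiholIdx j) x) := by
  rw [lefschetz_apply, omega_eq]
  simp only [wedgeOp_apply, smul_mul_assoc, Finset.sum_mul, mul_assoc]

/-- Taking adjoints in the coframe expression of `L` turns wedge products into contractions,
reverses their order and conjugates `i`. -/
theorem dualLefschetz_eq_sum (x : Forms V) : dualLefschetz b x =
    (-Complex.I) • ∑ j, contractOp b (antiholIdx j) (contractOp b (holIdx j) x) := by
  have h : dualLefschetz b =
      (-Complex.I) • ∑ j, contractOp b (antiholIdx j) * contractOp b (holIdx j) := by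
    refine adjointOp_eq_of b fun x y => ?_
    rw [lefschetz_eq_sum]
    simp only [LinearMap.smul_apply, LinearMap.sum_apply, Module.End.mul_apply,
      hermInner_smul_left, hermInner_smul_right, hermInner_sum_left, hermInner_sum_right,
      hermInner_wedgeOp_left, Complex.conj_I]
  rw [h]
  simp only [LinearMap.smul_apply, LinearMap.sum_apply, Module.End.mul_apply]

/-- The commutator of `Λ` with a wedge product is a multiple of a contraction, hence commutes with
`Λ`; dually for `L` and contractions. This is why the exponentials below act on these operators by
adding a single term. -/
theorem dualLefschetz_wedgeOp_holIdx (j : Fin n) (x : Forms V) :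
    dualLefschetz b (wedgeOp b (holIdx j) x) =
      wedgeOp b (holIdx j) (dualLefschetz b x) - Complex.I • contractOp b (antiholIdx j) x := by
  have h : ∀ k, contractOp b (antiholIdx k) (contractOp b (holIdx k) (wedgeOp b (holIdx j) x)) =
      wedgeOp b (holIdx j) (contractOp b (antiholIdx k) (contractOp b (holIdx k) x)) +
        if k = j then contractOp b (antiholIdx k) x else 0 := fun k => by
    rw [contractOp_wedgeOp, map_sub, contractOp_wedgeOp, if_neg (holIdx_ne_antiholIdx _ _).symm]
    simp only [holIdx_inj, apply_ite (contractOp b (antiholIdx k)), map_zero]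
    abel
  simp only [dualLefschetz_eq_sum, h, map_smul, map_sum, Finset.sum_add_distrib,
    Finset.sum_ite_eq', Finset.mem_univ, if_true, smul_add, neg_smul, map_neg, sub_eq_add_neg]

theorem dualLefschetz_wedgeOp_antiholIdx (j : Fin n) (x : Forms V) :
    dualLefschetz b (wedgeOp b (antiholIdx j) x) =
      wedgeOp b (antiholIdx j) (dualLefschetz b x) + Complex.I • contractOp b (holIdx j) x := by
  have h : ∀ k, contractOp b (antiholIdx k) (contractOp b (holIdx k) (wedgeOp b (antiholIdx j) x)) =
      wedgeOp b (antiholIdx j) (contractOp b (antiholIdx k) (contractOp b (holIdx k) x)) -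
        if k = j then contractOp b (holIdx k) x else 0 := fun k => by
    rw [contractOp_wedgeOp, if_neg (holIdx_ne_antiholIdx _ _), zero_sub, map_neg,
      contractOp_wedgeOp]
    simp only [antiholIdx_inj]
    abel
  simp only [dualLefschetz_eq_sum, h, map_smul, map_sum, Finset.sum_sub_distrib,
    Finset.sum_ite_eq', Finset.mem_univ, if_true, smul_sub, neg_smul, map_neg, sub_neg_eq_add]

theorem lefschetz_wedgeOp (s : Fin n ⊕ₗ Fin n) (x : Forms V) :
    lefschetz b (wedgeOp b s x) = wedgeOp b s (lefschetz b x) := by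
  simp only [lefschetz_eq_sum, map_smul, map_sum, wedgeOp_wedgeOp b _ s, map_neg, neg_neg]

theorem dualLefschetz_contractOp (s : Fin n ⊕ₗ Fin n) (x : Forms V) :
    dualLefschetz b (contractOp b s x) = contractOp b s (dualLefschetz b x) := by
  simp only [dualLefschetz_eq_sum, map_smul, map_sum, contractOp_contractOp b _ s, map_neg, neg_neg]

theorem lefschetz_contractOp_antiholIdx (j : Fin n) (x : Forms V) :
    lefschetz b (contractOp b (antiholIdx j) x) =
      contractOp b (antiholIdx j) (lefschetz b x) + Complex.I • wedgeOp b (holIdx j) x := by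
  have h : ∀ k, wedgeOp b (holIdx k) (wedgeOp b (antiholIdx k) (contractOp b (antiholIdx j) x)) =
      contractOp b (antiholIdx j) (wedgeOp b (holIdx k) (wedgeOp b (antiholIdx k) x)) +
        if k = j then wedgeOp b (holIdx k) x else 0 := fun k => by
    rw [wedgeOp_contractOp, map_sub, wedgeOp_contractOp, if_neg (holIdx_ne_antiholIdx _ _).symm]
    simp only [antiholIdx_inj, apply_ite (wedgeOp b (holIdx k)), map_zero, eq_comm (a := j)]
    abel
  simp only [lefschetz_eq_sum, h, map_smul, map_sum, Finset.sum_add_distrib,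
    Finset.sum_ite_eq', Finset.mem_univ, if_true, smul_add]

theorem lefschetz_contractOp_holIdx (j : Fin n) (x : Forms V) :
    lefschetz b (contractOp b (holIdx j) x) =
      contractOp b (holIdx j) (lefschetz b x) - Complex.I • wedgeOp b (antiholIdx j) x := by
  have h : ∀ k, wedgeOp b (holIdx k) (wedgeOp b (antiholIdx k) (contractOp b (holIdx j) x)) =
      contractOp b (holIdx j) (wedgeOp b (holIdx k) (wedgeOp b (antiholIdx k) x)) -
        if k = j then wedgeOp b (antiholIdx k) x else 0 := fun k => by
    rw [wedgeOp_contractOp, if_neg (holIdx_ne_antiholIdx _ _), zero_sub, map_neg,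
      wedgeOp_contractOp]
    simp only [holIdx_inj, eq_comm (a := j)]
    abel
  simp only [lefschetz_eq_sum, h, map_smul, map_sum, Finset.sum_sub_distrib,
    Finset.sum_ite_eq', Finset.mem_univ, if_true, smul_sub]

/-- The operator that multiplies forms of type `(p,q)` by `p`. -/
def holDegOp : Module.End ℂ (Forms V) := ∑ j, wedgeOp b (holIdx j) ∘ₗ contractOp b (holIdx j)

/-- The operator that multiplies forms of type `(p,q)` by `q`. -/
def antiholDegOp : Module.End ℂ (Forms V) :=
  ∑ j, wedgeOp b (antiholIdx j) ∘ₗ contractOp b (antiholIdx j)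

theorem holDegOp_apply (x : Forms V) :
    holDegOp b x = ∑ j, wedgeOp b (holIdx j) (contractOp b (holIdx j) x) := by
  simp [holDegOp]

theorem antiholDegOp_apply (x : Forms V) :
    antiholDegOp b x = ∑ j, wedgeOp b (antiholIdx j) (contractOp b (antiholIdx j) x) := by
  simp [antiholDegOp]

/-- For each `j`, moving `Λ` past the two wedge factors leaves the two number operators minus the
identity; the `n` identities add up to the constant. -/
theorem dualLefschetz_lefschetz (x : Forms V) : dualLefschetz b (lefschetz b x) =
    lefschetz b (dualLefschetz b x) + ((n : ℂ) • x - holDegOp b x - antiholDegOp b x) := by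
  have h : ∀ j, dualLefschetz b (wedgeOp b (holIdx j) (wedgeOp b (antiholIdx j) x)) =
      wedgeOp b (holIdx j) (wedgeOp b (antiholIdx j) (dualLefschetz b x)) +
        Complex.I • (wedgeOp b (holIdx j) (contractOp b (holIdx j) x)
          + wedgeOp b (antiholIdx j) (contractOp b (antiholIdx j) x) - x) := fun j => by
    rw [dualLefschetz_wedgeOp_holIdx, dualLefschetz_wedgeOp_antiholIdx, contractOp_wedgeOp,
      if_pos rfl, map_add, map_smul]
    module
  have hI : Complex.I * Complex.I = -1 := Complex.I_mul_I
  rw [lefschetz_eq_sum, map_smul, map_sum, lefschetz_eq_sum, holDegOp_apply, antiholDegOp_apply]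
  simp only [h, Finset.sum_add_distrib, ← Finset.smul_sum, Finset.sum_sub_distrib, smul_add,
    smul_sub, smul_smul, ← mul_assoc, hI, Finset.sum_const, Finset.card_univ, Fintype.card_fin,
    ← Nat.cast_smul_eq_nsmul ℂ]
  module

theorem conjForm_omega : conjForm (omega b) = omega b := by
  have h : ∀ j, ExteriorAlgebra.ι ℂ (coframe b (antiholIdx j)) *
      ExteriorAlgebra.ι ℂ (coframe b (holIdx j)) = -(ExteriorAlgebra.ι ℂ (coframe b (holIdx j)) *
      ExteriorAlgebra.ι ℂ (coframe b (antiholIdx j))) := fun j =>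
    eq_neg_of_add_eq_zero_left (ExteriorAlgebra.ι_add_mul_swap (R := ℂ) _ _)
  rw [omega_eq, conjForm_smul]
  simp only [map_sum, map_mul, conjForm_ι, conjCovector_coframe, barIdx_holIdx, barIdx_antiholIdx,
    h, Complex.conj_I, Finset.sum_neg_distrib, smul_neg, neg_smul, neg_neg]

/-- Conjugation swaps the two contractions in each term of `Λ`. The sign from reordering them
cancels the sign from conjugating `-i`. -/
theorem conjForm_dualLefschetz (x : Forms V) :
    conjForm (dualLefschetz b x) = dualLefschetz b (conjForm x) := by
  simp only [dualLefschetz_eq_sum, conjForm_smul, map_sum, conjForm_contractOp, barIdx_holIdx,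
    barIdx_antiholIdx, contractOp_contractOp b (holIdx _) (antiholIdx _), map_neg, Complex.conj_I,
    Finset.sum_neg_distrib, smul_neg, neg_smul, neg_neg]

theorem signOp_lefschetz (x : Forms V) : signOp (lefschetz b x) = lefschetz b (signOp x) := by
  simp only [lefschetz_eq_sum, map_smul, map_sum, signOp_wedgeOp, map_neg, neg_neg]

theorem signOp_dualLefschetz (x : Forms V) :
    signOp (dualLefschetz b x) = dualLefschetz b (signOp x) := by
  simp only [dualLefschetz_eq_sum, map_smul, map_sum, signOp_contractOp, map_neg, neg_neg]

end Commutators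

/-! ### Bidegree: number operators, orthogonality of types and the action of `𝐈` -/

section Types

variable {V : Type*} [NormedAddCommGroup V] [InnerProductSpace ℂ V] {n : ℕ}

variable (b : OrthonormalBasis (Fin n) ℂ V)

theorem restrictScalars_eq_sum_coframe (α : V →ₗ[ℂ] ℂ) :
    α.restrictScalars ℝ = ∑ j, (((√2 : ℝ) : ℂ) * α (b j)) • coframe b (holIdx j) := by
  have hs : ((√2 : ℝ) : ℂ) * ((√2 : ℝ) : ℂ)⁻¹ = 1 := mul_inv_cancel₀ (by simp)
  ext v
  conv_lhs => rw [← b.toBasis.sum_repr v]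
  rw [map_sum, LinearMap.sum_apply]
  refine Finset.sum_congr rfl fun j _ => ?_
  rw [coframe_holIdx, smul_smul, mul_right_comm, hs, one_mul, LinearMap.smul_apply, dz]
  simp [Module.Basis.coord_apply, mul_comm]

theorem mul_mem_of_mem_holForms {K : Submodule ℂ (Forms V)} {x y : Forms V}
    (h : ∀ j, wedgeOp b (holIdx j) y ∈ K) (hx : x ∈ holForms V) : x * y ∈ K := by
  induction hx using Submodule.span_induction with
  | zero => simp
  | add x x' _ _ h h' => rw [add_mul]; exact K.add_mem h h'
  | smul c x _ h => rw [smul_mul_assoc]; exact K.smul_mem c h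
  | mem x hx =>
    obtain ⟨α, rfl⟩ := hx
    rw [restrictScalars_eq_sum_coframe b, map_sum, Finset.sum_mul]
    refine K.sum_mem fun j _ => ?_
    rw [map_smul, smul_mul_assoc]
    exact K.smul_mem _ (h j)

theorem mul_mem_of_mem_antiholForms {K : Submodule ℂ (Forms V)} {x y : Forms V}
    (h : ∀ j, wedgeOp b (antiholIdx j) y ∈ K) (hx : x ∈ antiholForms V) : x * y ∈ K := by
  induction hx using Submodule.span_induction with
  | zero => simp
  | add x x' _ _ h h' => rw [add_mul]; exact K.add_mem h h'
  | smul c x _ h => rw [smul_mul_assoc]; exact K.smul_mem c h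
  | mem x hx =>
    obtain ⟨α, rfl⟩ := hx
    rw [← conjForm_ι, restrictScalars_eq_sum_coframe b, map_sum, map_sum, Finset.sum_mul]
    refine K.sum_mem fun j _ => ?_
    rw [map_smul, conjForm_smul, smul_mul_assoc, conjForm_ι, conjCovector_coframe]
    exact K.smul_mem _ (h j)

/-- A family of subspaces that contains `1` and is stable under multiplication by the coframe, with
the expected change of bidegree, contains the forms of type `(p,q)`. -/
theorem typeForms_le {K : ℕ → ℕ → Submodule ℂ (Forms V)} (h1 : 1 ∈ K 0 0)
    (hhol : ∀ p q j x, x ∈ K p q → wedgeOp b (holIdx j) x ∈ K (p + 1) q)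
    (hanti : ∀ p q j x, x ∈ K p q → wedgeOp b (antiholIdx j) x ∈ K p (q + 1)) (p q : ℕ) :
    typeForms V p q ≤ K p q := by
  induction p with
  | zero =>
    induction q with
    | zero =>
      rw [typeForms, pow_zero, pow_zero, one_mul, Submodule.one_le]
      exact h1
    | succ q ih =>
      rw [typeForms, pow_zero, one_mul] at ih ⊢
      rw [pow_succ', Submodule.mul_le]
      exact fun x hx y hy => mul_mem_of_mem_antiholForms b (fun j => hanti _ _ j y (ih hy)) hx
  | succ p ih =>
    rw [typeForms] at ih ⊢
    rw [pow_succ', mul_assoc, Submodule.mul_le]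
    exact fun x hx y hy => mul_mem_of_mem_holForms b (fun j => hhol _ _ j y (ih hy)) hx

theorem wedgeOp_mem_exteriorPower {k : ℕ} (s : Fin n ⊕ₗ Fin n) {x : Forms V}
    (hx : x ∈ ⋀[ℂ]^k (V →ₗ[ℝ] ℂ)) : wedgeOp b s x ∈ ⋀[ℂ]^(k + 1) (V →ₗ[ℝ] ℂ) := by
  rw [ExteriorAlgebra.exteriorPower, pow_succ']
  exact Submodule.mul_mem_mul (LinearMap.mem_range_self _ _) hx

theorem typeForms_le_exteriorPower (b : OrthonormalBasis (Fin n) ℂ V) (p q : ℕ) :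
    typeForms V p q ≤ ⋀[ℂ]^(p + q) (V →ₗ[ℝ] ℂ) := by
  refine typeForms_le b (K := fun p q => ⋀[ℂ]^(p + q) (V →ₗ[ℝ] ℂ)) ?_ (fun p q j x hx => ?_)
    (fun p q j x hx => wedgeOp_mem_exteriorPower b _ hx) p q
  · rw [ExteriorAlgebra.exteriorPower, add_zero, pow_zero]
    exact Submodule.one_le.mp le_rfl
  · rw [add_right_comm]
    exact wedgeOp_mem_exteriorPower b _ hx

theorem holDegOp_wedgeOp_holIdx (j : Fin n) (x : Forms V) :
    holDegOp b (wedgeOp b (holIdx j) x) =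
      wedgeOp b (holIdx j) x + wedgeOp b (holIdx j) (holDegOp b x) := by
  simp only [holDegOp_apply, contractOp_wedgeOp, holIdx_inj, map_sub, apply_ite (wedgeOp b _),
    map_zero, Finset.sum_ite_eq', Finset.mem_univ, if_true, map_sum,
    wedgeOp_wedgeOp b _ (holIdx j), Finset.sum_add_distrib, sub_neg_eq_add]

theorem holDegOp_wedgeOp_antiholIdx (j : Fin n) (x : Forms V) :
    holDegOp b (wedgeOp b (antiholIdx j) x) = wedgeOp b (antiholIdx j) (holDegOp b x) := by
  simp only [holDegOp_apply, contractOp_wedgeOp, holIdx_ne_antiholIdx, if_false, zero_sub, map_neg,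
    map_sum, wedgeOp_wedgeOp b _ (antiholIdx j), neg_neg]

theorem antiholDegOp_wedgeOp_antiholIdx (j : Fin n) (x : Forms V) :
    antiholDegOp b (wedgeOp b (antiholIdx j) x) =
      wedgeOp b (antiholIdx j) x + wedgeOp b (antiholIdx j) (antiholDegOp b x) := by
  simp only [antiholDegOp_apply, contractOp_wedgeOp, antiholIdx_inj, map_sub,
    apply_ite (wedgeOp b _), map_zero, Finset.sum_ite_eq', Finset.mem_univ,
    if_true, map_sum, wedgeOp_wedgeOp b _ (antiholIdx j), Finset.sum_add_distrib, sub_neg_eq_add]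

theorem antiholDegOp_wedgeOp_holIdx (j : Fin n) (x : Forms V) :
    antiholDegOp b (wedgeOp b (holIdx j) x) = wedgeOp b (holIdx j) (antiholDegOp b x) := by
  simp only [antiholDegOp_apply, contractOp_wedgeOp, (holIdx_ne_antiholIdx _ _).symm, if_false,
    zero_sub, map_neg, map_sum, wedgeOp_wedgeOp b _ (holIdx j), neg_neg]

theorem holDegOp_of_mem_typeForms {p q : ℕ} {x : Forms V} (hx : x ∈ typeForms V p q) :
    holDegOp b x = (p : ℂ) • x := by
  have := typeForms_le b
    (K := fun p _ => LinearMap.eqLocus (holDegOp b) ((p : ℂ) • LinearMap.id))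
    (by simp [LinearMap.mem_eqLocus, holDegOp_apply, contractOp_one])
    (fun p q j x hx => ?_) (fun p q j x hx => ?_) p q hx
  · simpa [LinearMap.mem_eqLocus] using this
  · simp only [LinearMap.mem_eqLocus, LinearMap.smul_apply, LinearMap.id_apply] at hx ⊢
    rw [holDegOp_wedgeOp_holIdx, hx, map_smul]; push_cast; module
  · simp only [LinearMap.mem_eqLocus, LinearMap.smul_apply, LinearMap.id_apply] at hx ⊢
    rw [holDegOp_wedgeOp_antiholIdx, hx, map_smul]

theorem antiholDegOp_of_mem_typeForms {p q : ℕ} {x : Forms V} (hx : x ∈ typeForms V p q) :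
    antiholDegOp b x = (q : ℂ) • x := by
  have := typeForms_le b
    (K := fun _ q => LinearMap.eqLocus (antiholDegOp b) ((q : ℂ) • LinearMap.id))
    (by simp [LinearMap.mem_eqLocus, antiholDegOp_apply, contractOp_one])
    (fun p q j x hx => ?_) (fun p q j x hx => ?_) p q hx
  · simpa [LinearMap.mem_eqLocus] using this
  · simp only [LinearMap.mem_eqLocus, LinearMap.smul_apply, LinearMap.id_apply] at hx ⊢
    rw [antiholDegOp_wedgeOp_holIdx, hx, map_smul]
  · simp only [LinearMap.mem_eqLocus, LinearMap.smul_apply, LinearMap.id_apply] at hx ⊢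
    rw [antiholDegOp_wedgeOp_antiholIdx, hx, map_smul]; push_cast; module

theorem hermInner_holDegOp_left (x y : Forms V) :
    hermInner b (holDegOp b x) y = hermInner b x (holDegOp b y) := by
  simp only [holDegOp_apply, hermInner_sum_left, hermInner_sum_right, hermInner_wedgeOp_left,
    hermInner_contractOp_left]

theorem hermInner_antiholDegOp_left (x y : Forms V) :
    hermInner b (antiholDegOp b x) y = hermInner b x (antiholDegOp b y) := by
  simp only [antiholDegOp_apply, hermInner_sum_left, hermInner_sum_right, hermInner_wedgeOp_left,
    hermInner_contractOp_left]

/-- The number operators are self-adjoint, and forms of different types have different real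
eigenvalues for one of them. -/
theorem hermInner_eq_zero_of_mem_typeForms {p q p' q' : ℕ} {x y : Forms V}
    (hx : x ∈ typeForms V p q) (hy : y ∈ typeForms V p' q') (h : p ≠ p' ∨ q ≠ q') :
    hermInner b x y = 0 := by
  rcases h with h | h
  · have := hermInner_holDegOp_left b x y
    rw [holDegOp_of_mem_typeForms b hx, holDegOp_of_mem_typeForms b hy, hermInner_smul_left,
      hermInner_smul_right, Complex.conj_natCast] at this
    exact (mul_eq_mul_right_iff.mp this).resolve_left (by exact_mod_cast h)
  · have := hermInner_antiholDegOp_left b x y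
    rw [antiholDegOp_of_mem_typeForms b hx, antiholDegOp_of_mem_typeForms b hy,
      hermInner_smul_left, hermInner_smul_right, Complex.conj_natCast] at this
    exact (mul_eq_mul_right_iff.mp this).resolve_left (by exact_mod_cast h)

theorem normSq_nonneg (x : Forms V) : 0 ≤ normSq b x := by unfold normSq; positivity

/-- The anticommutation relation of wedge and contraction says that the square norms of the two
images of `x` add up to `|x|²`. -/
theorem normSq_contractOp_le (s : Fin n ⊕ₗ Fin n) (x : Forms V) :
    normSq b (contractOp b s x) ≤ normSq b x := by
  have h : hermInner b (contractOp b s x) (contractOp b s x) +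
      hermInner b (wedgeOp b s x) (wedgeOp b s x) = hermInner b x x := by
    rw [hermInner_contractOp_left, hermInner_wedgeOp_left, ← hermInner_add_right,
      contractOp_wedgeOp, if_pos rfl]
    congr 1; abel
  simp only [hermInner_self] at h
  have h' : normSq b (contractOp b s x) + normSq b (wedgeOp b s x) = normSq b x := by
    exact_mod_cast h
  linarith [normSq_nonneg b (wedgeOp b s x)]

theorem eq_zero_of_normSq {x : Forms V} (h : normSq b x ≤ 0) : x = 0 := by
  apply eq_zero_of_hermInner_self b
  rw [hermInner_self, le_antisymm h (normSq_nonneg b x), Complex.ofReal_zero]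

/-- Pairing the eigenvalue equation with `x` writes `p |x|²` as a sum of `n` square norms of
contractions, each at most `|x|²`. -/
theorem eq_zero_of_lt_of_sum {x : Forms V} {p : ℕ} (hp : n < p) (f : Fin n → Fin n ⊕ₗ Fin n)
    (h : ∑ j, wedgeOp b (f j) (contractOp b (f j) x) = (p : ℂ) • x) : x = 0 := by
  have h1 : ∑ j, hermInner b (contractOp b (f j) x) (contractOp b (f j) x) =
      p * hermInner b x x := by
    rw [← hermInner_smul_right, ← h, hermInner_sum_right]
    exact Finset.sum_congr rfl fun j _ => hermInner_contractOp_left b _ _ _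
  simp only [hermInner_self] at h1
  have h2 : ∑ j, normSq b (contractOp b (f j) x) = p * normSq b x := by exact_mod_cast h1
  have h3 : ∑ j, normSq b (contractOp b (f j) x) ≤ n * normSq b x := by
    refine (Finset.sum_le_sum fun j _ => normSq_contractOp_le b (f j) x).trans ?_
    simp
  have h4 : (n : ℝ) + 1 ≤ p := by exact_mod_cast hp
  apply eq_zero_of_normSq b
  nlinarith [normSq_nonneg b x]

theorem eq_zero_of_mem_typeForms (b : OrthonormalBasis (Fin n) ℂ V) {p q : ℕ} {x : Forms V}
    (hx : x ∈ typeForms V p q) (h : n < p ∨ n < q) : x = 0 := by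
  rcases h with h | h
  · refine eq_zero_of_lt_of_sum b h holIdx ?_
    rw [← holDegOp_apply, holDegOp_of_mem_typeForms b hx]
  · refine eq_zero_of_lt_of_sum b h antiholIdx ?_
    rw [← antiholDegOp_apply, antiholDegOp_of_mem_typeForms b hx]

theorem orthProj_of_mem {W : Submodule ℂ (Forms V)} {x : Forms V} (hx : x ∈ W) :
    orthProj b W x = x := by
  have h : (W.map (orthoCoord b).toLinearMap).starProjection (orthoCoord b x) = orthoCoord b x :=
    Submodule.starProjection_eq_self_iff.mpr (Submodule.mem_map_of_mem hx)
  simp [orthProj, h]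

theorem orthProj_of_hermInner_eq_zero {W : Submodule ℂ (Forms V)} {x : Forms V}
    (hx : ∀ y ∈ W, hermInner b y x = 0) : orthProj b W x = 0 := by
  have h : (W.map (orthoCoord b).toLinearMap).starProjection (orthoCoord b x) = 0 := by
    rw [Submodule.starProjection_apply_eq_zero_iff, Submodule.mem_orthogonal]
    rintro _ ⟨y, hy, rfl⟩
    exact hx y hy
  simp [orthProj, h]

theorem opI_of_mem_typeForms {p q : ℕ} {x : Forms V} (hx : x ∈ typeForms V p q) :
    opI b x = Complex.I ^ ((p : ℤ) - q) • x := by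
  -- The double sum defining `𝐈` stops at `n`, so bidegrees beyond it are handled by showing that
  -- they contain only `0`.
  by_cases h : n < p ∨ n < q
  · rw [eq_zero_of_mem_typeForms b hx h, map_zero, smul_zero]
  push Not at h
  have h' : ∀ p' q', (p' ≠ p ∨ q' ≠ q) → orthProj b (typeForms V p' q') x = 0 :=
    fun p' q' hne => orthProj_of_hermInner_eq_zero b fun y hy =>
      hermInner_eq_zero_of_mem_typeForms b hy hx hne
  simp only [opI, LinearMap.sum_apply, LinearMap.smul_apply]
  rw [Finset.sum_eq_single_of_mem p (by simp; omega), Finset.sum_eq_single_of_mem q (by simp; omega),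
    orthProj_of_mem b hx]
  · intro q' _ hq'
    rw [h' p q' (Or.inr hq'), smul_zero]
  · intro p' _ hp'
    exact Finset.sum_eq_zero fun q' _ => by rw [h' p' q' (Or.inl hp'), smul_zero]

end Types

/-! ### `𝔰𝔩₂`-strings and exponentials of nilpotent operators -/

section Strings

theorem divPow_natCast {R : Type*} [Ring R] [Algebra ℂ R] (a : R) (k : ℕ) :
    divPow a (k : ℤ) = ((k ! : ℂ))⁻¹ • a ^ k := by
  simp [divPow]

theorem divPow_of_neg {R : Type*} [Ring R] [Algebra ℂ R] (a : R) {k : ℤ} (hk : k < 0) :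
    divPow a k = 0 := by
  simp [divPow, hk.not_ge]

theorem divPow_zero {R : Type*} [Ring R] [Algebra ℂ R] (a : R) : divPow a 0 = 1 := by
  simp [divPow]

theorem divPow_mul_divPow {R : Type*} [Ring R] [Algebra ℂ R] (a : R) (k m : ℕ) :
    divPow a (k : ℤ) * divPow a (m : ℤ) =
      ((k + m).choose k : ℂ) • divPow a ((k + m : ℕ) : ℤ) := by
  rw [divPow_natCast, divPow_natCast, divPow_natCast, smul_mul_smul_comm, ← pow_add, smul_smul]
  congr 1
  have h : ((k + m).choose k : ℂ) * k ! * m ! = (k + m)! := by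
    have := Nat.choose_mul_factorial_mul_factorial (Nat.le_add_right k m)
    rw [Nat.add_sub_cancel_left] at this
    exact_mod_cast this
  have h1 : (k ! : ℂ) ≠ 0 := by exact_mod_cast k.factorial_ne_zero
  have h2 : (m ! : ℂ) ≠ 0 := by exact_mod_cast m.factorial_ne_zero
  have h3 : ((k + m)! : ℂ) ≠ 0 := by exact_mod_cast (k + m).factorial_ne_zero
  field_simp
  linear_combination -h

section Linear

variable {W : Type*} [AddCommGroup W] [Module ℂ W] (A : Module.End ℂ W)

theorem apply_divPow (r : ℕ) (x : W) :
    A (divPow A (r : ℤ) x) = ((r : ℂ) + 1) • divPow A ((r + 1 : ℕ) : ℤ) x := by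
  have h1 : (r ! : ℂ) ≠ 0 := by exact_mod_cast r.factorial_ne_zero
  have h2 : ((r : ℂ) + 1) ≠ 0 := by exact_mod_cast r.succ_ne_zero
  rw [divPow_natCast, divPow_natCast, LinearMap.smul_apply, map_smul, LinearMap.smul_apply,
    pow_succ', Module.End.mul_apply, smul_smul, Nat.factorial_succ]
  congr 1
  push_cast
  field_simp

theorem divPow_succ_apply (r : ℕ) (x : W) :
    divPow A ((r + 1 : ℕ) : ℤ) x = ((r : ℂ) + 1)⁻¹ • A (divPow A (r : ℤ) x) := by
  have h2 : ((r : ℂ) + 1) ≠ 0 := by exact_mod_cast r.succ_ne_zero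
  rw [apply_divPow, inv_smul_smul₀ h2]

/-- A commutation rule for divided powers. -/
theorem divPow_apply_of_commutator {e D : Module.End ℂ W} (h : ∀ x, A (e x) = e (A x) + D x)
    (hD : ∀ x, A (D x) = D (A x)) (r : ℕ) (x : W) :
    divPow A (r : ℤ) (e x) = e (divPow A (r : ℤ) x) + D (divPow A ((r : ℤ) - 1) x) := by
  induction r with
  | zero => simp [divPow_zero, divPow_of_neg]
  | succ r ih =>
    have hD' : A (D (divPow A ((r : ℤ) - 1) x)) = (r : ℂ) • D (divPow A (r : ℤ) x) := by
      rw [hD]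
      cases r with
      | zero => simp [divPow_of_neg]
      | succ m =>
        have : ((m + 1 : ℕ) : ℤ) - 1 = m := by push_cast; ring
        rw [this, apply_divPow, map_smul]
        push_cast
        rfl
    have h2 : ((r : ℂ) + 1) ≠ 0 := by exact_mod_cast r.succ_ne_zero
    have h3 : ((r + 1 : ℕ) : ℤ) - 1 = r := by push_cast; ring
    rw [divPow_succ_apply, ih, map_add, h, hD', h3, apply_divPow, map_smul]
    have h4 : (r : ℂ) • D (divPow A (r : ℤ) x) + D (divPow A (r : ℤ) x) =
        ((r : ℂ) + 1) • D (divPow A (r : ℤ) x) := by module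
    rw [add_assoc, add_comm (D _), h4, ← smul_add, inv_smul_smul₀ h2]

/-- The `𝔰𝔩₂` relation for the strings of a primitive vector, of weight `N`, implies that these
strings are finite. -/
theorem pow_apply_eq_zero_of_primitive {L Λ : Module.End ℂ W} (hL : IsNilpotent L) {x : W} {N : ℤ}
    (h : ∀ r : ℕ, Λ ((L ^ (r + 1)) x) = (((r : ℂ) + 1) * (N - r)) • (L ^ r) x) {r : ℕ}
    (hr : N < r) : (L ^ r) x = 0 := by
  classical
  obtain ⟨M, hM⟩ := hL
  have hex : ∃ M, (L ^ M) x = 0 := ⟨M, by rw [hM, LinearMap.zero_apply]⟩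
  have hle : ∀ s, Nat.find hex ≤ s → (L ^ s) x = 0 := fun s hs => by
    rw [← Nat.sub_add_cancel hs, pow_add, Module.End.mul_apply, Nat.find_spec hex, map_zero]
  cases hm : Nat.find hex with
  | zero => exact hle r (hm ▸ Nat.zero_le _)
  | succ m =>
    have h0 : (L ^ m) x ≠ 0 := Nat.find_min hex (by omega)
    -- `L^{m+1}` is the first power that kills `x`. Applying `Λ` gives `0 = (m+1)(N-m) L^m x` with
    -- `L^m x ≠ 0`, hence `N = m`.
    have h1 := h m
    rw [← hm, Nat.find_spec hex, map_zero, eq_comm, smul_eq_zero, or_iff_left h0,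
      mul_eq_zero, or_iff_right (by exact_mod_cast m.succ_ne_zero), sub_eq_zero] at h1
    have h2 : N = m := by exact_mod_cast h1
    exact hle r (by omega)

theorem divPow_apply_eq_zero_of_primitive {L Λ : Module.End ℂ W} (hL : IsNilpotent L) {x : W}
    {N : ℤ} (h : ∀ r : ℕ, Λ ((L ^ (r + 1)) x) = (((r : ℂ) + 1) * (N - r)) • (L ^ r) x) {r : ℤ}
    (hr : N < r) : divPow L r x = 0 := by
  by_cases h0 : r < 0
  · rw [divPow_of_neg _ h0, LinearMap.zero_apply]
  · lift r to ℕ using not_lt.mp h0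
    rw [divPow_natCast, LinearMap.smul_apply, pow_apply_eq_zero_of_primitive hL h hr, smul_zero]

/-- Since `Λ L^{[t+1]} x = (N-t) L^{[t]} x`, each further `Λ` contributes one factor, absorbed by
`(m+1) C(m,l) = (l+1) C(m+1,l+1)`. For `t ≥ N` and `l > 0` both sides vanish, so the truncation in
`toNat` is harmless. -/
theorem divPow_divPow_apply_of_primitive {L Λ : Module.End ℂ W} (hL : IsNilpotent L) {x : W}
    {N : ℤ} (h : ∀ r : ℕ, Λ ((L ^ (r + 1)) x) = (((r : ℂ) + 1) * (N - r)) • (L ^ r) x)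
    (l t : ℕ) : divPow Λ (l : ℤ) (divPow L ((l + t : ℕ) : ℤ) x) =
      (((N - t).toNat.choose l : ℕ) : ℂ) • divPow L (t : ℤ) x := by
  induction l generalizing t with
  | zero => simp [divPow_zero]
  | succ l ih =>
    have h1 : l + 1 + t = l + (t + 1) := by ring
    rw [divPow_succ_apply, h1, ih, map_smul]
    rcases lt_or_ge (t : ℤ) N with ht | ht
    · obtain ⟨m, hm⟩ : ∃ m : ℕ, N = t + 1 + m := ⟨(N - t - 1).toNat, by omega⟩
      have e1 : (N - ((t + 1 : ℕ) : ℤ)).toNat = m := by omega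
      have e2 : (N - (t : ℤ)).toNat = m + 1 := by omega
      have hstep : Λ (divPow L ((t + 1 : ℕ) : ℤ) x) = ((m : ℂ) + 1) • divPow L (t : ℤ) x := by
        have h2 : ((t : ℂ) + 1) ≠ 0 := by exact_mod_cast t.succ_ne_zero
        have h3 : (t ! : ℂ) ≠ 0 := by exact_mod_cast t.factorial_ne_zero
        rw [divPow_natCast, divPow_natCast, LinearMap.smul_apply, map_smul, h,
          LinearMap.smul_apply, smul_smul, smul_smul, Nat.factorial_succ, hm]
        congr 1
        push_cast
        field_simp
        ring
      have hc : ((m : ℂ) + 1) * (m.choose l : ℂ) = ((m + 1).choose (l + 1) : ℂ) * (l + 1) := by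
        exact_mod_cast Nat.add_one_mul_choose_eq m l
      have h2 : ((l : ℂ) + 1) ≠ 0 := by exact_mod_cast l.succ_ne_zero
      rw [e1, e2, hstep, smul_smul, smul_smul]
      congr 1
      field_simp
      linear_combination hc
    · rw [divPow_apply_eq_zero_of_primitive hL h (r := ((t + 1 : ℕ) : ℤ)) (by push_cast; omega)]
      have e2 : (N - (t : ℤ)).toNat = 0 := by omega
      simp [e2]

/-- `Λ^{[r]}` already brings `L^{[r]} x` down to a multiple of `x`, which the next `Λ` kills. -/
theorem divPow_divPow_apply_of_primitive_of_lt {L Λ : Module.End ℂ W} (hL : IsNilpotent L) {x : W}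
    {N : ℤ} (h : ∀ r : ℕ, Λ ((L ^ (r + 1)) x) = (((r : ℂ) + 1) * (N - r)) • (L ^ r) x)
    (h0 : Λ x = 0) {l r : ℕ} (hlr : r < l) :
    divPow Λ (l : ℤ) (divPow L (r : ℤ) x) = 0 := by
  obtain ⟨m, rfl⟩ := Nat.exists_eq_add_of_lt hlr
  induction m with
  | zero =>
    rw [add_zero, divPow_succ_apply]
    have := divPow_divPow_apply_of_primitive hL h r 0
    rw [add_zero] at this
    rw [this, map_smul, Nat.cast_zero, divPow_zero, Module.End.one_apply, h0, smul_zero, smul_zero]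
  | succ m ih => rw [← add_assoc r m 1, divPow_succ_apply, ih (by omega), map_zero, smul_zero]

variable [Module ℚ W]

theorem exp_apply_eq_sum (hA : IsNilpotent A) {k : ℕ} {x : W} (h : (A ^ k) x = 0) :
    IsNilpotent.exp A x = ∑ r ∈ Finset.range k, divPow A (r : ℤ) x := by
  have h1 := IsNilpotent.exp_smul_eq_sum (M := W) (a := A) (m := x) (k := k) h hA
  rw [Module.End.smul_def] at h1
  rw [h1]
  refine Finset.sum_congr rfl fun r _ => ?_
  rw [divPow_natCast, LinearMap.smul_apply, Module.End.smul_def, ← Rat.cast_smul_eq_qsmul ℂ]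
  simp

/-- Since `D = [A, e]` commutes with `A`, the series of `exp(ad A) e` stops at `e + D`. -/
theorem exp_apply_of_commutator (hA : IsNilpotent A) {e D : Module.End ℂ W}
    (h : ∀ x, A (e x) = e (A x) + D x) (hD : ∀ x, A (D x) = D (A x)) (x : W) :
    IsNilpotent.exp A (e x) = e (IsNilpotent.exp A x) + D (IsNilpotent.exp A x) := by
  obtain ⟨M, hM⟩ := id hA
  have h0 : ∀ y, (A ^ M) y = 0 := fun y => by rw [hM, LinearMap.zero_apply]
  -- One term more than nilpotency requires: the sum multiplying `D` is shifted by one, and its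
  -- first term is `A^{[-1]} = 0`, so `M` terms of the exponential remain there.
  have h1 : ∀ y, (A ^ (M + 1)) y = 0 := fun y => by
    rw [pow_succ', Module.End.mul_apply, h0, map_zero]
  rw [exp_apply_eq_sum A hA (h1 (e x))]
  simp only [divPow_apply_of_commutator A h hD, Finset.sum_add_distrib]
  rw [← map_sum, ← exp_apply_eq_sum A hA (h1 x), ← map_sum, Finset.sum_range_succ']
  have h2 : ∀ r : ℕ, ((r + 1 : ℕ) : ℤ) - 1 = r := fun r => by push_cast; ring
  simp only [h2, ← exp_apply_eq_sum A hA (h0 x)]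
  simp [divPow_of_neg]

theorem exp_apply_of_commute (hA : IsNilpotent A) {e : Module.End ℂ W}
    (h : ∀ x, A (e x) = e (A x)) (x : W) :
    IsNilpotent.exp A (e x) = e (IsNilpotent.exp A x) := by
  have := exp_apply_of_commutator A hA (e := e) (D := 0) (by simpa using h) (by simp) x
  simpa using this

/-- The exponentials of an `𝔰𝔩₂`-triple reverse the string of a primitive vector. -/
theorem exp_exp_exp_apply_of_primitive {L Λ : Module.End ℂ W} (hL : IsNilpotent L)
    (hΛ : IsNilpotent Λ) {x : W} {N : ℤ}
    (h : ∀ r : ℕ, Λ ((L ^ (r + 1)) x) = (((r : ℂ) + 1) * (N - r)) • (L ^ r) x) (h0 : Λ x = 0) :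
    IsNilpotent.exp L (IsNilpotent.exp (-Λ) (IsNilpotent.exp L x)) = divPow L N x := by
  rcases lt_or_ge N 0 with hN | hN
  · have hx : x = 0 := by
      simpa using pow_apply_eq_zero_of_primitive hL h (r := 0) (by simpa using hN)
    simp [hx]
  lift N to ℕ using hN
  have h1 : (L ^ (N + 1)) x = 0 := pow_apply_eq_zero_of_primitive hL h (by push_cast; omega)
  have h2 : (Λ ^ (N + 1)) (divPow L (N : ℤ) x) = 0 := by
    have := divPow_divPow_apply_of_primitive_of_lt hL h h0 N.lt_succ_self
    rw [divPow_natCast, LinearMap.smul_apply, smul_eq_zero] at this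
    exact this.resolve_left (inv_ne_zero (by exact_mod_cast Nat.factorial_ne_zero _))
  -- Descending from the top of the string, `Λ^{[t]} L^{[N]} x = L^{[N-t]} x` with coefficient `1`,
  -- so both exponentials run over the same vectors in opposite order.
  have h3 : IsNilpotent.exp Λ (divPow L (N : ℤ) x) = IsNilpotent.exp L x := by
    rw [exp_apply_eq_sum Λ hΛ h2, exp_apply_eq_sum L hL h1,
      ← Finset.sum_range_reflect _ (N + 1)]
    refine Finset.sum_congr rfl fun r hr => ?_
    obtain ⟨t, ht⟩ := Nat.exists_eq_add_of_le (Nat.lt_succ_iff.mp (Finset.mem_range.mp hr))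
    have e : N + 1 - 1 - r = t := by omega
    have e2 : ((N : ℤ) - r).toNat = t := by omega
    have := divPow_divPow_apply_of_primitive hL h t r
    rw [e2, Nat.choose_self, Nat.cast_one, one_smul, add_comm t r, ← ht] at this
    rw [e, this]
  have h4 : IsNilpotent.exp (-Λ) (IsNilpotent.exp Λ (divPow L (N : ℤ) x)) =
      divPow L (N : ℤ) x :=
    LinearMap.congr_fun (IsNilpotent.exp_neg_mul_exp_self hΛ) _
  -- The top of the string is killed by `L`, so the outer `exp(L)` fixes it.
  have h5 : (L ^ 1) (divPow L (N : ℤ) x) = 0 := by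
    rw [divPow_natCast, LinearMap.smul_apply, map_smul, ← Module.End.mul_apply, ← pow_add,
      add_comm, h1, smul_zero]
  rw [← h3, h4, exp_apply_eq_sum L hL h5]
  simp [divPow_zero]

end Linear

end Strings

/-! ### Nilpotency of `L` and `Λ`, and strings of primitive forms -/

section Primitive

variable {V : Type*} [NormedAddCommGroup V] [InnerProductSpace ℂ V] {n : ℕ}

theorem finrank_exteriorPower (b : OrthonormalBasis (Fin n) ℂ V) (k : ℕ) :
    Module.finrank ℂ (⋀[ℂ]^k (V →ₗ[ℝ] ℂ)) = (2 * n).choose k := by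
  have : Module.Finite ℂ (V →ₗ[ℝ] ℂ) := Module.Finite.of_basis (coframe b)
  rw [exteriorPower.finrank_eq, Module.finrank_eq_card_basis (coframe b), Fintype.card_lex,
    Fintype.card_sum, Fintype.card_fin, two_mul]

theorem finite_exteriorPower (b : OrthonormalBasis (Fin n) ℂ V) (k : ℕ) :
    Module.Finite ℂ (⋀[ℂ]^k (V →ₗ[ℝ] ℂ)) := by
  have : Module.Finite ℂ (V →ₗ[ℝ] ℂ) := Module.Finite.of_basis (coframe b)
  infer_instance

theorem eq_zero_of_mem_exteriorPower (b : OrthonormalBasis (Fin n) ℂ V) {k : ℕ} (hk : 2 * n < k)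
    {x : Forms V} (hx : x ∈ ⋀[ℂ]^k (V →ₗ[ℝ] ℂ)) : x = 0 := by
  -- Finiteness is needed to conclude from rank `0`, which is also the default value of `finrank` in
  -- infinite dimension.
  have := finite_exteriorPower b k
  have h0 : Module.finrank ℂ (⋀[ℂ]^k (V →ₗ[ℝ] ℂ)) = 0 := by
    rw [finrank_exteriorPower b, Nat.choose_eq_zero_of_lt hk]
  have := Module.finrank_zero_iff.mp h0
  exact congrArg Subtype.val (Subsingleton.elim (⟨x, hx⟩ : ⋀[ℂ]^k (V →ₗ[ℝ] ℂ)) 0)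

theorem mul_mem_exteriorPower {k m : ℕ} {x y : Forms V} (hx : x ∈ ⋀[ℂ]^k (V →ₗ[ℝ] ℂ))
    (hy : y ∈ ⋀[ℂ]^m (V →ₗ[ℝ] ℂ)) : x * y ∈ ⋀[ℂ]^(k + m) (V →ₗ[ℝ] ℂ) := by
  rw [ExteriorAlgebra.exteriorPower, pow_add]
  exact Submodule.mul_mem_mul hx hy

theorem pow_mem_exteriorPower {k : ℕ} {x : Forms V} (hx : x ∈ ⋀[ℂ]^k (V →ₗ[ℝ] ℂ)) (r : ℕ) :
    x ^ r ∈ ⋀[ℂ]^(k * r) (V →ₗ[ℝ] ℂ) := by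
  rw [ExteriorAlgebra.exteriorPower, pow_mul]
  exact Submodule.pow_mem_pow _ hx r

theorem conjForm_mem_exteriorPower {k : ℕ} {x : Forms V} (hx : x ∈ ⋀[ℂ]^k (V →ₗ[ℝ] ℂ)) :
    conjForm x ∈ ⋀[ℂ]^k (V →ₗ[ℝ] ℂ) := by
  induction k generalizing x with
  | zero =>
    rw [ExteriorAlgebra.exteriorPower, pow_zero, Submodule.mem_one] at hx ⊢
    obtain ⟨r, rfl⟩ := hx
    exact ⟨conj r, (conjForm_algebraMap r).symm⟩
  | succ k ih =>
    rw [ExteriorAlgebra.exteriorPower, pow_succ'] at hx ⊢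
    induction hx using Submodule.mul_induction_on' with
    | mem_mul_mem x hx y hy =>
      obtain ⟨α, rfl⟩ := hx
      rw [map_mul, conjForm_ι]
      exact Submodule.mul_mem_mul (LinearMap.mem_range_self _ _) (ih hy)
    | add x _ y _ hx hy => rw [map_add]; exact Submodule.add_mem _ hx hy

variable (b : OrthonormalBasis (Fin n) ℂ V)

theorem omega_mem_exteriorPower : omega b ∈ ⋀[ℂ]^2 (V →ₗ[ℝ] ℂ) := by
  refine Submodule.smul_mem _ _ (Submodule.sum_mem _ fun j _ => ?_)
  rw [ExteriorAlgebra.exteriorPower, pow_two]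
  exact Submodule.mul_mem_mul (LinearMap.mem_range_self _ _) (LinearMap.mem_range_self _ _)

theorem divPow_omega_mem_exteriorPower (r : ℕ) :
    divPow (omega b) (r : ℤ) ∈ ⋀[ℂ]^(2 * r) (V →ₗ[ℝ] ℂ) := by
  rw [divPow_natCast]
  exact Submodule.smul_mem _ _ (pow_mem_exteriorPower (omega_mem_exteriorPower b) r)

theorem omega_mul_comm (x : Forms V) : omega b * x = x * omega b := by
  induction x using forms_induction with
  | h0 r => exact (Algebra.commutes r (omega b)).symm
  | hadd x y hx hy => rw [mul_add, add_mul, hx, hy]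
  | hι α x hx =>
    have hα : omega b * ExteriorAlgebra.ι ℂ α = ExteriorAlgebra.ι ℂ α * omega b := by
      have h := (coframe b).mem_span α
      induction h using Submodule.span_induction with
      | zero => simp
      | add x y _ _ hx hy => rw [map_add, mul_add, add_mul, hx, hy]
      | smul c x _ hx => rw [map_smul, mul_smul_comm, smul_mul_assoc, hx]
      | mem x hx =>
        obtain ⟨s, rfl⟩ := hx
        have h := lefschetz_wedgeOp b s 1
        simpa only [lefschetz_apply, wedgeOp_apply, mul_one] using h
    rw [← mul_assoc, hα, mul_assoc, hx, mul_assoc]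

theorem lefschetz_pow_apply (r : ℕ) (x : Forms V) : (lefschetz b ^ r) x = omega b ^ r * x := by
  induction r with
  | zero => simp
  | succ r ih => rw [pow_succ', Module.End.mul_apply, ih, lefschetz_apply, pow_succ', mul_assoc]

theorem divPow_lefschetz_apply (r : ℤ) (x : Forms V) :
    divPow (lefschetz b) r x = x * divPow (omega b) r := by
  rcases lt_or_ge r 0 with hr | hr
  · rw [divPow_of_neg _ hr, divPow_of_neg _ hr, mul_zero, LinearMap.zero_apply]
  · lift r to ℕ using hr
    have h : omega b ^ r * x = x * omega b ^ r := Commute.pow_left (omega_mul_comm b x) r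
    rw [divPow_natCast, divPow_natCast, LinearMap.smul_apply, lefschetz_pow_apply, mul_smul_comm, h]

theorem divPow_omega_mul_comm (r : ℤ) (x : Forms V) :
    divPow (omega b) r * x = x * divPow (omega b) r := by
  rcases lt_or_ge r 0 with hr | hr
  · rw [divPow_of_neg _ hr, mul_zero, zero_mul]
  · lift r to ℕ using hr
    have h : omega b ^ r * x = x * omega b ^ r := Commute.pow_left (omega_mul_comm b x) r
    rw [divPow_natCast, mul_smul_comm, smul_mul_assoc, h]

theorem isNilpotent_lefschetz : IsNilpotent (lefschetz b) := by
  refine ⟨n + 1, LinearMap.ext fun x => ?_⟩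
  rw [lefschetz_pow_apply, eq_zero_of_mem_exteriorPower b (k := 2 * (n + 1)) (by omega)
    (pow_mem_exteriorPower (omega_mem_exteriorPower b) (n + 1)), zero_mul, LinearMap.zero_apply]

theorem hermInner_dualLefschetz_right (x y : Forms V) :
    hermInner b x (dualLefschetz b y) = hermInner b (lefschetz b x) y :=
  hermInner_adjointOp_right b _ x y

theorem hermInner_dualLefschetz_pow_right (r : ℕ) (x y : Forms V) :
    hermInner b x ((dualLefschetz b ^ r) y) = hermInner b ((lefschetz b ^ r) x) y := by
  induction r generalizing x with
  | zero => simp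
  | succ r ih =>
    rw [pow_succ', Module.End.mul_apply, hermInner_dualLefschetz_right, ih, pow_succ,
      Module.End.mul_apply]

theorem isNilpotent_dualLefschetz : IsNilpotent (dualLefschetz b) := by
  obtain ⟨M, hM⟩ := isNilpotent_lefschetz b
  refine ⟨M, LinearMap.ext fun x => ext_hermInner b fun z => ?_⟩
  rw [hermInner_dualLefschetz_pow_right, hM, LinearMap.zero_apply, LinearMap.zero_apply,
    hermInner_zero_left, hermInner_zero_right]

theorem divPow_dualLefschetz_conjForm (l : ℤ) (x : Forms V) :
    divPow (dualLefschetz b) l (conjForm x) = conjForm (divPow (dualLefschetz b) l x) := by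
  rcases lt_or_ge l 0 with hl | hl
  · rw [divPow_of_neg _ hl, LinearMap.zero_apply, LinearMap.zero_apply, map_zero]
  · lift l to ℕ using hl
    induction l with
    | zero => simp [divPow_zero]
    | succ l ih =>
      rw [divPow_succ_apply, ih, divPow_succ_apply, conjForm_smul, conjForm_dualLefschetz]
      simp

theorem conjForm_divPow_omega (r : ℤ) : conjForm (divPow (omega b) r) = divPow (omega b) r := by
  rcases lt_or_ge r 0 with hr | hr
  · rw [divPow_of_neg _ hr, map_zero]
  · lift r to ℕ using hr
    rw [divPow_natCast, conjForm_smul, map_pow, conjForm_omega]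
    simp

/-! ### Primitive forms -/

/-- The operator that multiplies forms of degree `k` by `k`. -/
def degOp : Module.End ℂ (Forms V) := holDegOp b + antiholDegOp b

theorem degOp_of_mem_typeForms {p q : ℕ} {x : Forms V} (hx : x ∈ typeForms V p q) :
    degOp b x = ((p + q : ℕ) : ℂ) • x := by
  rw [degOp, LinearMap.add_apply, holDegOp_of_mem_typeForms b hx,
    antiholDegOp_of_mem_typeForms b hx]
  push_cast
  module

theorem degOp_lefschetz (x : Forms V) :
    degOp b (lefschetz b x) = lefschetz b (degOp b x) + (2 : ℂ) • lefschetz b x := by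
  simp only [degOp, LinearMap.add_apply, lefschetz_eq_sum, map_smul, map_sum, map_add,
    holDegOp_wedgeOp_holIdx, holDegOp_wedgeOp_antiholIdx, antiholDegOp_wedgeOp_holIdx,
    antiholDegOp_wedgeOp_antiholIdx, Finset.sum_add_distrib]
  module

/-- The commutators met along the string add up: the sum of `n-k-2s` over `0 ≤ s ≤ r` is
`(r+1)(n-k-r)`. The weight `n-k` is an integer, as it is negative above the middle degree. -/
theorem dualLefschetz_lefschetz_pow {k : ℕ} {x : Forms V} (hk : degOp b x = (k : ℂ) • x)
    (hx : dualLefschetz b x = 0) (r : ℕ) :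
    dualLefschetz b ((lefschetz b ^ (r + 1)) x) =
      (((r : ℂ) + 1) * (((n : ℤ) - k : ℤ) - r)) • (lefschetz b ^ r) x := by
  have hdeg : ∀ r : ℕ, degOp b ((lefschetz b ^ r) x) =
      ((k : ℂ) + 2 * r) • (lefschetz b ^ r) x := fun r => by
    induction r with
    | zero => simpa using hk
    | succ r ih =>
      rw [pow_succ', Module.End.mul_apply, degOp_lefschetz, ih, map_smul]
      push_cast
      module
  have hcomm : ∀ y, dualLefschetz b (lefschetz b y) =
      lefschetz b (dualLefschetz b y) + ((n : ℂ) • y - degOp b y) := fun y => by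
    rw [dualLefschetz_lefschetz, degOp, LinearMap.add_apply, sub_sub]
  induction r with
  | zero =>
    rw [zero_add, pow_one, hcomm, hx, hk, map_zero]
    push_cast
    simp only [pow_zero, Module.End.one_apply]
    module
  | succ r ih =>
    rw [pow_succ', Module.End.mul_apply, hcomm, ih, hdeg, map_smul,
      ← Module.End.mul_apply (lefschetz b), ← pow_succ']
    push_cast
    module

theorem divPow_dualLefschetz_divPow_lefschetz {k : ℕ} {x : Forms V}
    (hk : degOp b x = (k : ℂ) • x) (hx : dualLefschetz b x = 0) (l t : ℕ) :
    divPow (dualLefschetz b) (l : ℤ) (divPow (lefschetz b) ((l + t : ℕ) : ℤ) x) =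
      ((n - k - t).choose l : ℂ) • divPow (lefschetz b) (t : ℤ) x := by
  rw [divPow_divPow_apply_of_primitive (isNilpotent_lefschetz b)
    (dualLefschetz_lefschetz_pow b hk hx)]
  congr 4
  omega

theorem divPow_dualLefschetz_divPow_lefschetz_of_lt {k : ℕ} {x : Forms V}
    (hk : degOp b x = (k : ℂ) • x) (hx : dualLefschetz b x = 0) {l r : ℕ} (h : r < l) :
    divPow (dualLefschetz b) (l : ℤ) (divPow (lefschetz b) (r : ℤ) x) = 0 :=
  divPow_divPow_apply_of_primitive_of_lt (isNilpotent_lefschetz b)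
    (dualLefschetz_lefschetz_pow b hk hx) hx h

theorem divPow_lefschetz_eq_zero {k : ℕ} {x : Forms V}
    (hk : degOp b x = (k : ℂ) • x) (hx : dualLefschetz b x = 0) {r : ℤ} (h : (n : ℤ) - k < r) :
    divPow (lefschetz b) r x = 0 :=
  divPow_apply_eq_zero_of_primitive (isNilpotent_lefschetz b)
    (dualLefschetz_lefschetz_pow b hk hx) h

/-- Adjunction moves `L^{[r]}` across as `Λ^{[r]}`, which brings the string back to a multiple of
`x`. -/
theorem hermInner_divPow_lefschetz {k : ℕ} {x : Forms V}
    (hk : degOp b x = (k : ℂ) • x) (hx : dualLefschetz b x = 0) (r : ℕ) :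
    hermInner b (divPow (lefschetz b) (r : ℤ) x) (divPow (lefschetz b) (r : ℤ) x) =
      ((n - k).choose r : ℂ) * hermInner b x x := by
  have h : ∀ y, hermInner b (divPow (lefschetz b) (r : ℤ) x) y =
      hermInner b x (divPow (dualLefschetz b) (r : ℤ) y) := fun y => by
    rw [divPow_natCast, divPow_natCast, LinearMap.smul_apply, LinearMap.smul_apply,
      hermInner_smul_left, hermInner_smul_right, hermInner_dualLefschetz_pow_right]
    simp
  have h2 := divPow_dualLefschetz_divPow_lefschetz b hk hx r 0
  rw [add_zero] at h2
  rw [h, h2, hermInner_smul_right]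
  simp [divPow_zero]

end Primitive

/-! ### The Weyl element and the Hodge–Riemann relation -/

section Weyl

variable {V : Type*} [NormedAddCommGroup V] [InnerProductSpace ℂ V] {n : ℕ}

variable (b : OrthonormalBasis (Fin n) ℂ V)

/-- The Weyl element `exp(L) exp(-Λ) exp(L)` acting on forms. -/
def weylOp (x : Forms V) : Forms V :=
  IsNilpotent.exp (lefschetz b) (IsNilpotent.exp (-dualLefschetz b)
    (IsNilpotent.exp (lefschetz b) x))

theorem weylOp_add (x y : Forms V) : weylOp b (x + y) = weylOp b x + weylOp b y := by
  simp only [weylOp, map_add]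

theorem weylOp_smul (c : ℂ) (x : Forms V) : weylOp b (c • x) = c • weylOp b x := by
  simp only [weylOp, map_smul]

theorem weylOp_zero : weylOp b 0 = 0 := by simp only [weylOp, map_zero]

theorem exp_lefschetz_wedgeOp (s : Fin n ⊕ₗ Fin n) (x : Forms V) :
    IsNilpotent.exp (lefschetz b) (wedgeOp b s x) =
      wedgeOp b s (IsNilpotent.exp (lefschetz b) x) :=
  exp_apply_of_commute _ (isNilpotent_lefschetz b) (lefschetz_wedgeOp b s) x

theorem exp_dualLefschetz_contractOp (s : Fin n ⊕ₗ Fin n) (x : Forms V) :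
    IsNilpotent.exp (-dualLefschetz b) (contractOp b s x) =
      contractOp b s (IsNilpotent.exp (-dualLefschetz b) x) :=
  exp_apply_of_commute _ (isNilpotent_dualLefschetz b).neg
    (fun x => by rw [LinearMap.neg_apply, LinearMap.neg_apply, dualLefschetz_contractOp, map_neg]) x

theorem exp_lefschetz_contractOp_antiholIdx (j : Fin n) (x : Forms V) :
    IsNilpotent.exp (lefschetz b) (contractOp b (antiholIdx j) x) =
      contractOp b (antiholIdx j) (IsNilpotent.exp (lefschetz b) x) +
        Complex.I • wedgeOp b (holIdx j) (IsNilpotent.exp (lefschetz b) x) :=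
  exp_apply_of_commutator _ (isNilpotent_lefschetz b) (e := contractOp b (antiholIdx j))
    (D := Complex.I • wedgeOp b (holIdx j)) (lefschetz_contractOp_antiholIdx b j)
    (fun x => by rw [LinearMap.smul_apply, LinearMap.smul_apply, map_smul, lefschetz_wedgeOp]) x

theorem exp_lefschetz_contractOp_holIdx (j : Fin n) (x : Forms V) :
    IsNilpotent.exp (lefschetz b) (contractOp b (holIdx j) x) =
      contractOp b (holIdx j) (IsNilpotent.exp (lefschetz b) x) +
        (-Complex.I) • wedgeOp b (antiholIdx j) (IsNilpotent.exp (lefschetz b) x) :=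
  exp_apply_of_commutator _ (isNilpotent_lefschetz b) (e := contractOp b (holIdx j))
    (D := (-Complex.I) • wedgeOp b (antiholIdx j))
    (fun x => by rw [lefschetz_contractOp_holIdx, LinearMap.smul_apply]; module)
    (fun x => by rw [LinearMap.smul_apply, LinearMap.smul_apply, map_smul, lefschetz_wedgeOp]) x

theorem exp_dualLefschetz_wedgeOp_holIdx (j : Fin n) (x : Forms V) :
    IsNilpotent.exp (-dualLefschetz b) (wedgeOp b (holIdx j) x) =
      wedgeOp b (holIdx j) (IsNilpotent.exp (-dualLefschetz b) x) +
        Complex.I • contractOp b (antiholIdx j) (IsNilpotent.exp (-dualLefschetz b) x) :=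
  exp_apply_of_commutator _ (isNilpotent_dualLefschetz b).neg (e := wedgeOp b (holIdx j))
    (D := Complex.I • contractOp b (antiholIdx j))
    (fun x => by
      rw [LinearMap.neg_apply, LinearMap.neg_apply, dualLefschetz_wedgeOp_holIdx,
        LinearMap.smul_apply, map_neg]
      module)
    (fun x => by
      rw [LinearMap.smul_apply, LinearMap.smul_apply, map_smul, LinearMap.neg_apply,
        LinearMap.neg_apply, dualLefschetz_contractOp, map_neg]) x

theorem exp_dualLefschetz_wedgeOp_antiholIdx (j : Fin n) (x : Forms V) :
    IsNilpotent.exp (-dualLefschetz b) (wedgeOp b (antiholIdx j) x) =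
      wedgeOp b (antiholIdx j) (IsNilpotent.exp (-dualLefschetz b) x) +
        (-Complex.I) • contractOp b (holIdx j) (IsNilpotent.exp (-dualLefschetz b) x) :=
  exp_apply_of_commutator _ (isNilpotent_dualLefschetz b).neg (e := wedgeOp b (antiholIdx j))
    (D := (-Complex.I) • contractOp b (holIdx j))
    (fun x => by
      rw [LinearMap.neg_apply, LinearMap.neg_apply, dualLefschetz_wedgeOp_antiholIdx,
        LinearMap.smul_apply, map_neg]
      module)
    (fun x => by
      rw [LinearMap.smul_apply, LinearMap.smul_apply, map_smul, LinearMap.neg_apply,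
        LinearMap.neg_apply, dualLefschetz_contractOp, map_neg]) x

theorem I_smul_I_smul (x : Forms V) : Complex.I • Complex.I • x = -x := by
  rw [smul_smul, Complex.I_mul_I, neg_one_smul]

theorem neg_I_smul_neg_I_smul (x : Forms V) : (-Complex.I) • (-Complex.I) • x = -x := by
  rw [smul_smul, neg_mul_neg, Complex.I_mul_I, neg_one_smul]

/-- With `ι` the contraction of `θ̄_j`, passing `exp(-Λ)` turns `θ_j` into `θ_j + iι`, and passing
the outer `exp(L)` turns this into `θ_j + i(ι + iθ_j) = iι`. The other three rules arise from the
same cancellation. -/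
theorem weylOp_wedgeOp_holIdx (j : Fin n) (x : Forms V) :
    weylOp b (wedgeOp b (holIdx j) x) = Complex.I • contractOp b (antiholIdx j) (weylOp b x) := by
  rw [weylOp, exp_lefschetz_wedgeOp, exp_dualLefschetz_wedgeOp_holIdx, map_add, map_smul,
    exp_lefschetz_wedgeOp, exp_lefschetz_contractOp_antiholIdx, smul_add, I_smul_I_smul, weylOp]
  abel

theorem weylOp_wedgeOp_antiholIdx (j : Fin n) (x : Forms V) :
    weylOp b (wedgeOp b (antiholIdx j) x) =
      (-Complex.I) • contractOp b (holIdx j) (weylOp b x) := by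
  rw [weylOp, exp_lefschetz_wedgeOp, exp_dualLefschetz_wedgeOp_antiholIdx, map_add, map_smul,
    exp_lefschetz_wedgeOp, exp_lefschetz_contractOp_holIdx, smul_add, neg_I_smul_neg_I_smul, weylOp]
  abel

theorem weylOp_contractOp_antiholIdx (j : Fin n) (x : Forms V) :
    weylOp b (contractOp b (antiholIdx j) x) = Complex.I • wedgeOp b (holIdx j) (weylOp b x) := by
  rw [weylOp, exp_lefschetz_contractOp_antiholIdx, map_add, map_smul,
    exp_dualLefschetz_contractOp, exp_dualLefschetz_wedgeOp_holIdx, smul_add, I_smul_I_smul,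
    add_comm, neg_add_cancel_right, map_smul, exp_lefschetz_wedgeOp, weylOp]

theorem weylOp_contractOp_holIdx (j : Fin n) (x : Forms V) :
    weylOp b (contractOp b (holIdx j) x) =
      (-Complex.I) • wedgeOp b (antiholIdx j) (weylOp b x) := by
  rw [weylOp, exp_lefschetz_contractOp_holIdx, map_add, map_smul,
    exp_dualLefschetz_contractOp, exp_dualLefschetz_wedgeOp_antiholIdx, smul_add,
    neg_I_smul_neg_I_smul, add_comm, neg_add_cancel_right, map_smul, exp_lefschetz_wedgeOp, weylOp]

theorem signOp_weylOp (x : Forms V) : signOp (weylOp b x) = weylOp b (signOp x) := by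
  have hL : ∀ x, IsNilpotent.exp (lefschetz b) (signOp x) =
      signOp (IsNilpotent.exp (lefschetz b) x) :=
    exp_apply_of_commute _ (isNilpotent_lefschetz b) (e := signOp.toLinearMap)
      (fun x => (signOp_lefschetz b x).symm)
  have hΛ : ∀ x, IsNilpotent.exp (-dualLefschetz b) (signOp x) =
      signOp (IsNilpotent.exp (-dualLefschetz b) x) :=
    exp_apply_of_commute _ (isNilpotent_dualLefschetz b).neg (e := signOp.toLinearMap)
      (fun x => by
        simp only [LinearMap.neg_apply, AlgHom.toLinearMap_apply, map_neg, signOp_dualLefschetz])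
  rw [weylOp, weylOp, hL, hΛ, hL]

theorem weylOp_of_primitive {k : ℕ} {x : Forms V} (hk : degOp b x = (k : ℂ) • x)
    (hx : dualLefschetz b x = 0) : weylOp b x = divPow (lefschetz b) ((n : ℤ) - k) x :=
  exp_exp_exp_apply_of_primitive (isNilpotent_lefschetz b) (isNilpotent_dualLefschetz b)
    (dualLefschetz_lefschetz_pow b hk hx) hx

theorem one_mem_typeForms : (1 : Forms V) ∈ typeForms V 0 0 := by
  rw [typeForms, pow_zero, pow_zero, one_mul]
  exact Submodule.one_le.mp le_rfl

theorem degOp_one : degOp b 1 = ((0 : ℕ) : ℂ) • 1 :=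
  degOp_of_mem_typeForms b one_mem_typeForms

theorem dualLefschetz_one : dualLefschetz b 1 = 0 := by
  simp [dualLefschetz_eq_sum, contractOp_one]

theorem weylOp_one : weylOp b 1 = divPow (omega b) n := by
  rw [weylOp_of_primitive b (degOp_one b) (dualLefschetz_one b), divPow_lefschetz_apply, one_mul]
  simp

/-- Up to a unit this is the image under the Weyl element of a contraction of `1`. -/
theorem wedgeOp_divPow_omega (s : Fin n ⊕ₗ Fin n) : wedgeOp b s (divPow (omega b) n) = 0 := by
  rw [← weylOp_one]
  induction s using idx_cases with
  | h j =>
    have h := weylOp_contractOp_antiholIdx b j 1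
    rw [contractOp_one, weylOp_zero] at h
    exact (smul_eq_zero.mp h.symm).resolve_left Complex.I_ne_zero
  | h' j =>
    have h := weylOp_contractOp_holIdx b j 1
    rw [contractOp_one, weylOp_zero] at h
    exact (smul_eq_zero.mp h.symm).resolve_left (neg_ne_zero.mpr Complex.I_ne_zero)

theorem hermInner_one_one : hermInner b 1 1 = 1 := by
  rw [← exteriorBasis_empty (coframe b), hermInner_exteriorBasis, if_pos rfl]

theorem hermInner_divPow_omega :
    hermInner b (divPow (omega b) n) (divPow (omega b) n) = 1 := by
  have h := hermInner_divPow_lefschetz b (degOp_one b) (dualLefschetz_one b) n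
  rw [divPow_lefschetz_apply, one_mul, hermInner_one_one] at h
  simpa using h

/-- The top exterior power is a line and `ω^{[n]}` is a unit vector in it, so an identity of top
forms can be checked by pairing with `ω^{[n]}`. -/
theorem eq_smul_of_mem_exteriorPower {x : Forms V} (hx : x ∈ ⋀[ℂ]^(2 * n) (V →ₗ[ℝ] ℂ)) :
    x = hermInner b (divPow (omega b) n) x • divPow (omega b) n := by
  have h1 : Module.finrank ℂ (⋀[ℂ]^(2 * n) (V →ₗ[ℝ] ℂ)) = 1 := by
    rw [finrank_exteriorPower b, Nat.choose_self]
  have hvol := hermInner_divPow_omega b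
  have h0 : (⟨_, divPow_omega_mem_exteriorPower b n⟩ : ⋀[ℂ]^(2 * n) (V →ₗ[ℝ] ℂ)) ≠ 0 := by
    intro h
    have h' : divPow (omega b) (n : ℤ) = 0 := congrArg Subtype.val h
    rw [h', hermInner_zero_left] at hvol
    exact zero_ne_one hvol
  obtain ⟨c, hc⟩ := exists_smul_eq_of_finrank_eq_one h1 h0 ⟨x, hx⟩
  have hc' : c • divPow (omega b) (n : ℤ) = x := congrArg Subtype.val hc
  rw [← hc', hermInner_smul_right, hvol, mul_one]

theorem hermInner_divPow_omega_contractOp (s : Fin n ⊕ₗ Fin n) (x : Forms V) :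
    hermInner b (divPow (omega b) n) (contractOp b s x) = 0 := by
  rw [← hermInner_wedgeOp_left, wedgeOp_divPow_omega, hermInner_zero_left]

/-- Both sides see only the scalar part of `y`. This is the base case of
`hermInner_weylOp_mul_conjForm`. -/
theorem hermInner_divPow_omega_mul_conjForm (y : Forms V) :
    hermInner b (divPow (omega b) n) (divPow (omega b) n * conjForm y) = hermInner b y 1 := by
  induction y using forms_induction with
  | h0 r =>
    rw [conjForm_algebraMap, Algebra.algebraMap_eq_smul_one, mul_smul_comm, mul_one,
      hermInner_smul_right, hermInner_divPow_omega, Algebra.algebraMap_eq_smul_one,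
      hermInner_smul_left, hermInner_one_one]
  | hadd x y hx hy =>
    rw [map_add, mul_add, hermInner_add_right, hermInner_add_left, hx, hy]
  | hι α x _ =>
    have hα := (coframe b).mem_span α
    induction hα using Submodule.span_induction with
    | zero => simp [hermInner_zero_left, hermInner_zero_right]
    | add α β _ _ h h' =>
      rw [map_add, add_mul, map_add, mul_add, hermInner_add_right, hermInner_add_left, h, h']
    | smul c α _ h =>
      rw [map_smul, smul_mul_assoc, conjForm_smul, mul_smul_comm, hermInner_smul_right, h,
        hermInner_smul_left]
    | mem α hα =>
      obtain ⟨s, rfl⟩ := hα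
      rw [← wedgeOp_apply, hermInner_wedgeOp_left, contractOp_one, hermInner_zero_right,
        conjForm_wedgeOp, wedgeOp_apply, ← mul_assoc, divPow_omega_mul_comm, ← wedgeOp_apply,
        wedgeOp_divPow_omega, zero_mul, hermInner_zero_right]

/-- The sign and power of `i` in the Hodge–Riemann relations for forms of type `(p,q)`. -/
def hodgeSign (p q : ℕ) : ℂ :=
  (-1) ^ ((p + q) * (p + q + 1) / 2) * Complex.I ^ p * (-Complex.I) ^ q

theorem triangle_succ (k : ℕ) : (k + 1) * (k + 1 + 1) / 2 = k * (k + 1) / 2 + (k + 1) := by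
  rw [← Nat.add_mul_div_left _ _ two_pos]
  congr 1
  ring

theorem hodgeSign_succ_left (p q : ℕ) :
    hodgeSign (p + 1) q = -(Complex.I * (-1) ^ (p + q) * hodgeSign p q) := by
  rw [hodgeSign, hodgeSign, add_right_comm, triangle_succ]
  ring

theorem hodgeSign_succ_right (p q : ℕ) :
    hodgeSign p (q + 1) = Complex.I * (-1) ^ (p + q) * hodgeSign p q := by
  rw [hodgeSign, hodgeSign, ← add_assoc, triangle_succ]
  ring

/-- Integration by parts: contraction is an antiderivation, and the contraction of a product is
orthogonal to `ω^{[n]}`. The bar on the index comes from conjugating the second factor. -/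
theorem hermInner_contractOp_mul_conjForm {k : ℕ} {z : Forms V}
    (hz : signOp z = (-1 : ℂ) ^ k • z) (s : Fin n ⊕ₗ Fin n) (y : Forms V) :
    hermInner b (divPow (omega b) n) (contractOp b (barIdx s) z * conjForm y) =
      -((-1) ^ k * hermInner b (divPow (omega b) n) (z * conjForm (contractOp b s y))) := by
  have h := hermInner_divPow_omega_contractOp b (barIdx s) (z * conjForm y)
  rw [contractOp_mul, hermInner_add_right, hz, ← conjForm_contractOp, smul_mul_assoc,
    hermInner_smul_right] at h
  exact eq_neg_of_add_eq_zero_left h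

/-- The Weyl element represents the Hermitian inner product, up to the conjugation and the
Hodge–Riemann sign. -/
theorem hermInner_weylOp_mul_conjForm {p q : ℕ} {x : Forms V} (hx : x ∈ typeForms V p q)
    (y : Forms V) : hermInner b (divPow (omega b) n) (weylOp b x * conjForm y) =
      hodgeSign p q * hermInner b y x := by
  -- Parity is carried along with the identity because integration by parts needs the parity of `w
  -- x`, which is that of `x` since `L` and `Λ` are even.
  let K : ℕ → ℕ → Submodule ℂ (Forms V) := fun p q =>
    { carrier := {x | signOp x = (-1 : ℂ) ^ (p + q) • x ∧
        ∀ y, hermInner b (divPow (omega b) n) (weylOp b x * conjForm y) =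
          hodgeSign p q * hermInner b y x}
      add_mem' := fun {x x'} hx hx' => ⟨by rw [map_add, hx.1, hx'.1, smul_add], fun y => by
        rw [weylOp_add, add_mul, hermInner_add_right, hermInner_add_right, hx.2, hx'.2, mul_add]⟩
      zero_mem' := ⟨by simp, fun y => by
        rw [weylOp_zero, zero_mul, hermInner_zero_right, hermInner_zero_right, mul_zero]⟩
      smul_mem' := fun c x hx => ⟨by rw [map_smul, hx.1, smul_comm], fun y => by
        rw [weylOp_smul, smul_mul_assoc, hermInner_smul_right, hermInner_smul_right, hx.2,
          mul_left_comm]⟩ }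
  have hsign : ∀ {k : ℕ} {x : Forms V} (s), signOp x = (-1 : ℂ) ^ k • x →
      signOp (wedgeOp b s x) = (-1 : ℂ) ^ (k + 1) • wedgeOp b s x := fun s h => by
    rw [signOp_wedgeOp, h, map_smul]
    module
  have hweyl : ∀ {k : ℕ} {x : Forms V}, signOp x = (-1 : ℂ) ^ k • x →
      signOp (weylOp b x) = (-1 : ℂ) ^ k • weylOp b x := fun h => by
    rw [signOp_weylOp, h, weylOp_smul]
  have hK : x ∈ K p q := by
    refine typeForms_le b (K := K) ⟨by simp, fun y => ?_⟩ (fun p q j x hx => ⟨?_, fun y => ?_⟩)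
      (fun p q j x hx => ⟨?_, fun y => ?_⟩) p q hx
    · rw [weylOp_one, hermInner_divPow_omega_mul_conjForm]
      simp [hodgeSign]
    · rw [add_right_comm]
      exact hsign _ hx.1
    · rw [weylOp_wedgeOp_holIdx, smul_mul_assoc, hermInner_smul_right, ← barIdx_holIdx,
        hermInner_contractOp_mul_conjForm b (hweyl hx.1), hx.2, hermInner_contractOp_left,
        hodgeSign_succ_left]
      ring
    · exact hsign _ hx.1
    · rw [weylOp_wedgeOp_antiholIdx, smul_mul_assoc, hermInner_smul_right, ← barIdx_antiholIdx,
        hermInner_contractOp_mul_conjForm b (hweyl hx.1), hx.2, hermInner_contractOp_left,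
        hodgeSign_succ_right]
      ring
  exact hK.2 y

/-- The Hodge–Riemann relation for a primitive form. -/
theorem mul_conjForm_mul_divPow_omega {p q : ℕ} {x : Forms V} (hx : x ∈ typeForms V p q)
    (hp : dualLefschetz b x = 0) :
    x * conjForm x * divPow (omega b) ((n : ℤ) - (p + q : ℕ)) =
      (hodgeSign p q * hermInner b x x) • divPow (omega b) n := by
  have hk := degOp_of_mem_typeForms b hx
  rcases lt_or_ge n (p + q) with h | h
  · have h0 : x = 0 := by
      have := divPow_lefschetz_eq_zero b hk hp (r := 0) (by omega)
      rwa [divPow_zero] at this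
    rw [h0, zero_mul, zero_mul, hermInner_zero_left, mul_zero, zero_smul]
  obtain ⟨m, rfl⟩ := Nat.exists_eq_add_of_le h
  have hm : ((p + q + m : ℕ) : ℤ) - (p + q : ℕ) = m := by push_cast; ring
  have hmem : x * conjForm x * divPow (omega b) (m : ℤ) ∈
      ⋀[ℂ]^(2 * (p + q + m)) (V →ₗ[ℝ] ℂ) := by
    have hx' := typeForms_le_exteriorPower b p q hx
    have := mul_mem_exteriorPower (mul_mem_exteriorPower hx' (conjForm_mem_exteriorPower hx'))
      (divPow_omega_mem_exteriorPower b m)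
    convert this using 2
    ring
  have h1 := hermInner_weylOp_mul_conjForm b hx x
  rw [weylOp_of_primitive b hk hp, divPow_lefschetz_apply, mul_assoc, divPow_omega_mul_comm,
    ← mul_assoc, hm] at h1
  rw [hm, eq_smul_of_mem_exteriorPower b hmem, h1]

end Weyl

/-! ### Binomial identities and products of strings -/

section Products

variable {V : Type*} [NormedAddCommGroup V] [InnerProductSpace ℂ V] {n : ℕ}

/-- Two trinomial revisions, both extracting the factor `C(2t+M, t)`, make the two sides equal. -/
theorem choose_mul_choose_mul_choose (t l M : ℕ) :
    (t + M).choose l * ((t + t).choose t * (t + t + M).choose (t + t)) =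
      (t + l).choose l * (t + M).choose t * (t + t + M).choose (t + l) := by
  have h1 : (t + t + M).choose (t + t) * (t + t).choose t =
      (t + t + M).choose t * (t + M).choose t := by
    have := Nat.choose_mul (n := t + t + M) (k := t + t) (s := t) (by omega)
    rwa [Nat.add_sub_cancel_left, show t + t + M - t = t + M by omega] at this
  have h2 : (t + t + M).choose (t + l) * (t + l).choose t =
      (t + t + M).choose t * (t + M).choose l := by
    have := Nat.choose_mul (n := t + t + M) (k := t + l) (s := t) (by omega)
    rwa [Nat.add_sub_cancel_left, show t + t + M - t = t + M by omega] at this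
  have h3 : (t + l).choose l = (t + l).choose t := (Nat.choose_symm_add).symm
  rw [h3, mul_comm ((t + t).choose t), h1,
    show (t + l).choose t * (t + M).choose t * (t + t + M).choose (t + l) =
      (t + t + M).choose (t + l) * (t + l).choose t * (t + M).choose t by ring, h2]
  ring

theorem divPow_mul_divPow_mul_divPow {R : Type*} [Ring R] [Algebra ℂ R] (a : R) (s t m : ℕ) :
    divPow a (s : ℤ) * divPow a (t : ℤ) * divPow a (m : ℤ) =
      ((s + t).choose s * (s + t + m).choose (s + t) : ℂ) •
        divPow a ((s + t + m : ℕ) : ℤ) := by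
  rw [divPow_mul_divPow, smul_mul_assoc, divPow_mul_divPow, smul_smul]

/-- The powers of `i` cancel in pairs `i · (-i) = 1`, and the triangular number of `2j+d` has the
parity of that of `d` plus `j`. -/
theorem conj_I_zpow_mul_hodgeSign (p d j : ℕ) :
    conj (Complex.I ^ ((p : ℤ) - (p + d : ℕ))) * hodgeSign j (j + d) =
      (-1) ^ j * (-1) ^ (d * (d + 1) / 2) := by
  have h1 : (p : ℤ) - (p + d : ℕ) = -(d : ℤ) := by push_cast; ring
  have h2 : (j + (j + d)) * (j + (j + d) + 1) / 2 = d * (d + 1) / 2 + (2 * (j * (j + d)) + j) := by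
    rw [← Nat.add_mul_div_left _ _ two_pos]
    congr 1
    ring
  have h3 : Complex.I ^ j * (-Complex.I) ^ j = 1 := by
    rw [← mul_pow, mul_neg, Complex.I_mul_I, neg_neg, one_pow]
  have h4 : Complex.I ^ d * (-Complex.I) ^ d = 1 := by
    rw [← mul_pow, mul_neg, Complex.I_mul_I, neg_neg, one_pow]
  rw [h1, zpow_neg, zpow_natCast, ← inv_pow, Complex.inv_I, map_pow, map_neg, Complex.conj_I,
    neg_neg, hodgeSign, h2, pow_add _ j d, pow_add, pow_add, pow_mul (-1 : ℂ) 2, neg_one_sq,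
    one_pow, one_mul]
  linear_combination (-1 : ℂ) ^ (d * (d + 1) / 2) * (-1) ^ j * (h4 + Complex.I ^ d *
    (-Complex.I) ^ d * h3)

variable (b : OrthonormalBasis (Fin n) ℂ V)

/-- The summands with `p - j < l` die because `Λ^{[l]}` lowers past the primitive end of their
strings; the others follow the string formula. -/
theorem divPow_dualLefschetz_of_decomposition {p d l : ℕ} {u : Forms V} {c : ℕ → Forms V}
    (hc : IsPrimitiveDecomposition b p (p + d) u c) :
    divPow (dualLefschetz b) (l : ℤ) u = ∑ j ∈ Finset.range (p + 1 - l),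
      ((n + l - j - (p + d)).choose l : ℂ) • (c j * divPow (omega b) ((p - l - j : ℕ) : ℤ)) := by
  have hd : p + d - p = d := by omega
  have hk : ∀ j ≤ p, degOp b (c j) = ((j + (j + d) : ℕ) : ℂ) • c j := fun j hj =>
    degOp_of_mem_typeForms b (by simpa only [hd] using hc.mem_type j hj)
  rw [hc.eq_sum, map_sum]
  symm
  refine Finset.sum_subset_zero_on_sdiff (fun j hj => ?_) (fun j hj => ?_) (fun j hj => ?_)
  · rw [Finset.mem_range] at hj ⊢; omega
  · rw [Finset.mem_sdiff, Finset.mem_range, Finset.mem_range] at hj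
    obtain ⟨r, rfl⟩ := Nat.exists_eq_add_of_le (Nat.lt_succ_iff.mp hj.1)
    rw [show ((j + r : ℕ) : ℤ) - j = r by push_cast; ring, ← divPow_lefschetz_apply]
    exact divPow_dualLefschetz_divPow_lefschetz_of_lt b (hk j (by omega))
      (hc.primitive j (by omega)) (by omega)
  · rw [Finset.mem_range] at hj
    obtain ⟨t, rfl⟩ : ∃ t, p = j + (l + t) := ⟨p - l - j, by omega⟩
    rw [show ((j + (l + t) : ℕ) : ℤ) - j = (l + t : ℕ) by push_cast; ring,
      ← divPow_lefschetz_apply b (l + t : ℕ), divPow_dualLefschetz_divPow_lefschetz b (hk j (by omega))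
      (hc.primitive j (by omega)), divPow_lefschetz_apply]
    rw [show j + (l + t) - l - j = t by omega,
      show n + l - j - (j + (l + t) + d) = n - (j + (j + d)) - t by omega]

/-- All powers of `ω` can be gathered on either factor, because `ω` is central and real; the
hypothesis says that they exceed the string of one of them. -/
theorem mul_conjForm_eq_zero {p q p' q' s t : ℕ} {m : ℤ} {x y : Forms V} (hx : x ∈ typeForms V p q)
    (hxp : dualLefschetz b x = 0) (hy : y ∈ typeForms V p' q') (hyp : dualLefschetz b y = 0)
    (h : (n : ℤ) - (p + q) < s + t + m ∨ (n : ℤ) - (p' + q') < s + t + m) :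
    x * divPow (omega b) (s : ℤ) * conjForm (y * divPow (omega b) (t : ℤ)) * divPow (omega b) m =
      0 := by
  rcases lt_or_ge m 0 with hm | hm
  · rw [divPow_of_neg _ hm, mul_zero]
  lift m to ℕ using hm
  have e1 : x * divPow (omega b) (s : ℤ) * conjForm (y * divPow (omega b) (t : ℤ)) *
      divPow (omega b) (m : ℤ) = x * conjForm y *
        (divPow (omega b) (s : ℤ) * divPow (omega b) (t : ℤ) * divPow (omega b) (m : ℤ)) := by
    rw [map_mul, conjForm_divPow_omega, mul_assoc x, ← mul_assoc _ (conjForm y),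
      divPow_omega_mul_comm]
    simp only [mul_assoc]
  rw [e1, divPow_mul_divPow_mul_divPow, mul_smul_comm]
  rcases h with h | h
  · have h0 := divPow_lefschetz_eq_zero b (degOp_of_mem_typeForms b hx) hxp
      (r := ((s + t + m : ℕ) : ℤ)) (by push_cast; omega)
    rw [divPow_lefschetz_apply] at h0
    rw [mul_assoc, ← divPow_omega_mul_comm, ← mul_assoc, h0, zero_mul, smul_zero]
  · have h0 := divPow_lefschetz_eq_zero b (degOp_of_mem_typeForms b hy) hyp
      (r := ((s + t + m : ℕ) : ℤ)) (by push_cast; omega)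
    rw [divPow_lefschetz_apply] at h0
    have h1 := congrArg conjForm h0
    rw [map_mul, conjForm_divPow_omega, map_zero] at h1
    rw [mul_assoc, h1, mul_zero, smul_zero]

theorem normSq_divPow_lefschetz {k : ℕ} {x : Forms V}
    (hk : degOp b x = (k : ℂ) • x) (hx : dualLefschetz b x = 0) (r : ℕ) :
    (normSq b (divPow (lefschetz b) (r : ℤ) x) : ℂ) = ((n - k).choose r : ℂ) * hermInner b x x := by
  rw [← hermInner_self, hermInner_divPow_lefschetz b hk hx]

theorem choose_smul_mul_conjForm {d j l t : ℕ} {x : Forms V} (hx : x ∈ typeForms V j (j + d))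
    (hp : dualLefschetz b x = 0) {m : ℤ} (hm : m = (n : ℤ) - (j + (j + d)) - t - t) :
    (((n + l - j - (j + l + t + d)).choose l : ℂ) * (n + l - j - (j + l + t + d)).choose l) •
      (x * divPow (omega b) (t : ℤ) * conjForm (x * divPow (omega b) (t : ℤ)) *
        divPow (omega b) m) =
    (hodgeSign j (j + d) * ((t + l).choose l * (n + l - j - (j + l + t + d)).choose t *
      (n + l - j - (j + l + t + d)).choose l *
      normSq b (divPow (lefschetz b) ((t + l : ℕ) : ℤ) x))) • divPow (omega b) n := by
  have hk := degOp_of_mem_typeForms b hx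
  rcases lt_or_ge m 0 with hm0 | hm0
  · rw [divPow_of_neg _ hm0, mul_zero, smul_zero]
    symm
    -- The left side is zero by the convention for negative powers. On the right, either the natural
    -- subtraction truncates and `L^{[t+l]} x = 0`, or the top of the binomial coefficient over `t`
    -- is less than `t`.
    rcases lt_or_ge (n + l) (j + (j + l + t + d)) with hn | hn
    · rw [divPow_lefschetz_eq_zero b hk hp (by push_cast; omega)]
      simp [normSq]
    · rw [Nat.choose_eq_zero_of_lt (k := t) (by omega)]
      simp
  lift m to ℕ using hm0
  have hn : n = j + (j + d) + (t + t + m) := by omega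
  have e0 : n + l - j - (j + l + t + d) = t + m := by omega
  have e1 : x * divPow (omega b) (t : ℤ) * conjForm (x * divPow (omega b) (t : ℤ)) *
      divPow (omega b) (m : ℤ) = x * conjForm x *
        (divPow (omega b) (t : ℤ) * divPow (omega b) (t : ℤ) * divPow (omega b) (m : ℤ)) := by
    rw [map_mul, conjForm_divPow_omega, mul_assoc x, ← mul_assoc _ (conjForm x),
      divPow_omega_mul_comm]
    simp only [mul_assoc]
  have e2 : ((t + t + m : ℕ) : ℤ) = (n : ℤ) - (j + (j + d) : ℕ) := by omega
  have e3 : n - (j + (j + d)) = t + t + m := by omega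
  have e4 := congrArg (Nat.cast (R := ℂ)) (choose_mul_choose_mul_choose t l m)
  push_cast at e4
  rw [e1, divPow_mul_divPow_mul_divPow, e2, mul_smul_comm, mul_conjForm_mul_divPow_omega b hx hp,
    smul_smul, smul_smul, e0, normSq_divPow_lefschetz b hk hp, e3]
  congr 1
  linear_combination ((t + m).choose l : ℂ) * hodgeSign j (j + d) * hermInner b x x * e4

end Products

end Forms

end

/-! ### The formula: expansion into a double sum and its diagonal -/

theorem mainTheorem2 {V : Type*} [NormedAddCommGroup V] [InnerProductSpace ℂ V] (n : ℕ)
    (b : OrthonormalBasis (Fin n) ℂ V) (p q l : ℕ) (hpq : p ≤ q)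
    (u : Forms V) (hu : u ∈ Forms.typeForms V p q)
    (c : ℕ → Forms V) (hc : Forms.IsPrimitiveDecomposition b p q u c) :
    Forms.divPow (Forms.dualLefschetz b) l u
        * Forms.divPow (Forms.dualLefschetz b) l (Forms.conjForm (Forms.opI b u))
        * Forms.divPow (Forms.omega b) ((n : ℤ) - p - q + 2 * l)
      = ∑ j ∈ Finset.range (p + 1 - l),
          ((-1 : ℂ) ^ j * (-1 : ℂ) ^ ((q - p) * (q - p + 1) / 2)
            * ((p - j).choose l : ℂ)
            * ((n + l - j - q).choose (p - l - j) : ℂ)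
            * ((n + l - j - q).choose l : ℂ)
            * (Forms.normSq b (Forms.divPow (Forms.lefschetz b) ((p : ℤ) - j) (c j)) : ℂ))
          • Forms.divPow (Forms.omega b) n := by
  obtain ⟨d, rfl⟩ := Nat.exists_eq_add_of_le hpq
  have hd : p + d - p = d := by omega
  have htype : ∀ j ≤ p, c j ∈ Forms.typeForms V j (j + d) := fun j hj => by
    simpa only [hd] using hc.mem_type j hj
  rw [Forms.opI_of_mem_typeForms b hu, Forms.conjForm_smul, map_smul,
    Forms.divPow_dualLefschetz_conjForm, Forms.divPow_dualLefschetz_of_decomposition b hc,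
    map_sum, mul_smul_comm, smul_mul_assoc, Finset.sum_mul, Finset.sum_mul, Finset.smul_sum]
  refine Finset.sum_congr rfl fun j hj => ?_
  rw [Finset.mem_range] at hj
  rw [Finset.mul_sum, Finset.sum_mul, Finset.sum_eq_single_of_mem j (Finset.mem_range.mpr hj)]
  · obtain ⟨t, rfl⟩ : ∃ t, p = j + l + t := ⟨p - l - j, by omega⟩
    have h := Forms.choose_smul_mul_conjForm b (l := l) (t := t) (htype j (by omega))
      (hc.primitive j (by omega)) (m := (n : ℤ) - (j + l + t : ℕ) - (j + l + t + d : ℕ) + 2 * l)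
      (by push_cast; ring)
    have hs := Forms.conj_I_zpow_mul_hodgeSign (j + l + t) d j
    rw [Forms.conjForm_smul, smul_mul_smul_comm, smul_mul_assoc, Complex.conj_natCast, hd,
      show j + l + t - l - j = t by omega, h, smul_smul, ← mul_assoc, hs,
      show j + l + t - j = t + l by omega,
      show ((j + l + t : ℕ) : ℤ) - j = (t + l : ℕ) by push_cast; ring]
    congr 1
    ring
  -- Off the diagonal, the gathered power `n-d-i-j` of `ω` exceeds `n-d-2 max(i,j)`, so the
  -- component of larger index is annihilated.
  · intro i hi hij
    rw [Finset.mem_range] at hi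
    rw [Forms.conjForm_smul, smul_mul_smul_comm, smul_mul_assoc,
      Forms.mul_conjForm_eq_zero b (htype j (by omega)) (hc.primitive j (by omega))
        (htype i (by omega)) (hc.primitive i (by omega)), smul_zero]
    push_cast
    omega
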